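/- Let $p$ be a prime, $q=p^r$, $\mathbb{F}_q$ the field with $q$ elements, $l$ a prime with $l\neq 2$ and $l\neq p$, and $k$ a field with $\operatorname{char} k\neq l$. Let $d$ be the smallest positive integer such that $l\mid q^d-1$; for $n\ge 0$ put $n_0=\lfloor n/d\rfloor$. *Essential dimension.* For a finite group $G$ and a field $F\supseteq k$, a $G$-torsor over $F$ is a nonzero commutative $F$-algebra $A$ with an action of $G$ by $F$-algebra automorphisms such that $A\otimes_F A\to\prod_{g\in G}A$, $a\otimes b\mapsto (a\,g(b))_g$, is bijective (a Galois $G$-algebra). Its essential $l$-dimension $\operatorname{ed}_k(A,l)$ is the minimum of $\operatorname{trdeg}_k K$ over all finite extensions $E/F$ with $l\nmid [E:F]$ and all intermediate fields $k\subseteq K\subseteq E$ for which there is a $G$-torsor $B$ over $K$ with $E\otimes_K B\cong E\otimes_F A$ as $G$-torsors over $E$. The essential $l$-dimension $\operatorname{ed}_k(G,l)$ is the supremum of $\operatorname{ed}_k(A,l)$ over all $F\supseteq k$ and all $G$-torsors $A$ over $F$. *Groups.* Consider the quadratic forms * $n=2m+1$, $m\ge 0$: $Q(z,x,y)=cz^2+\sum_{i=1}^m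 x_iy_i$ with any $c\in\mathbb{F}_q^\times$; * $n=2m$, $m\ge 0$, $\epsilon=+$: $Q(x,y)=\sum_{i=1}^m x_iy_i$; * $n=2m$, $m\ge 1$, $\epsilon=-$: $Q(w,x,y)=N(w)+\sum_{i=1}^{m-1}x_iy_i$ with any anisotropic quadratic form $N$ on $\mathbb{F}_q^2$. Let $O^\epsilon(n,q)=\{M\in GL_n(\mathbb{F}_q): Q(Mv)=Q(v)\text{ for all } v\}$ (no sign $\epsilon$ when $n$ is odd), let $SO^\epsilon(n,q)$ be its subgroup of elements of determinant $1$, let $\Omega^\epsilon(n,q)$ be the commutator subgroup of $SO^\epsilon(n,q)$, and $P\Omega^\epsilon(n,q)=\Omega^\epsilon(n,q)/(\Omega^\epsilon(n,q)\cap\{\pm \mathrm{Id}\})$. Then $$\operatorname{ed}_k(O^\epsilon(n,q),l)=\begin{cases} \operatorname{ed}_k(GL_m(\mathbb{F}_q),l), & n=2m+1,\ d \text{ odd},\\ & \text{or } n=2m,\ d\text{ odd},\ \epsilon=+,\\ \operatorname{ed}_k(GL_{m-1}(\mathbb{F}_q),l), & n=2m,\ d\text{ odd},\ \epsilon=-,\\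 \operatorname{ed}_k(GL_{2m}(\mathbb{F}_q),l), & n=2m+1,\ d\text{ even},\\ & \text{or } n=2m,\ d\text{ even},\ n_0\text{ even},\ \epsilon=+,\\ & \text{or } n=2m,\ d\text{ even},\ n_0\text{ odd},\ \epsilon=-,\\ \operatorname{ed}_k(GL_{2m-2}(\mathbb{F}_q),l), & n=2m,\ d\text{ even},\ n_0\text{ odd},\ \epsilon=+,\\ & \text{or } n=2m,\ d\text{ even},\ n_0\text{ even},\ \epsilon=-, \end{cases}$$ and, unless $n=2$ and $p\neq 2$, $$\operatorname{ed}_k(P\Omega^\epsilon(n,q),l)=\operatorname{ed}_k(O^\epsilon(n,q),l).$$ -/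

import Mathlib

open scoped TensorProduct MatrixGroups

universe u v

noncomputable section

namespace EssDim

/-- For a `G`-action on a commutative `F`-algebra `A`, the map `A ⊗ A → ∏_{g ∈ G} A`,
`a ⊗ b ↦ (a * g(b))_g`. It is the comorphism of `X × G → X × X`, `(x, g) ↦ (x, xg)`,
where `X = Spec A`. -/
def torsorMap (G : Type v) [Group G] (F : Type u) [Field F] (A : Type u) [CommRing A]
    [Algebra F A] [MulSemiringAction G A] [SMulCommClass G F A] :
    A ⊗[F] A →ₐ[F] (G → A) :=
  Algebra.TensorProduct.lift (Pi.constAlgHom F G A)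
    (AlgHom.pi fun g : G => MulSemiringAction.toAlgHom F A g) (fun _ _ => Commute.all _ _)

/-- A Galois `G`-algebra over a field `F`, i.e. (the coordinate ring of) a `G`-torsor over `Spec F`
for the finite constant group `G`. -/
structure GaloisAlgebra (G : Type v) [Group G] (F : Type u) [Field F] where
  carrier : Type u
  [commRing : CommRing carrier]
  [algebra : Algebra F carrier]
  [action : MulSemiringAction G carrier]
  [smulComm : SMulCommClass G F carrier]
  nontrivial : Nontrivial carrier
  bijective : Function.Bijective (torsorMap G F carrier)

attribute [instance] GaloisAlgebra.commRing GaloisAlgebra.algebra GaloisAlgebra.action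
  GaloisAlgebra.smulComm

/-- The action of `g ∈ G` on the base change `E ⊗[F] A`. -/
def baseChangeAct {G : Type v} [Group G] {F : Type u} [Field F] (A : GaloisAlgebra G F)
    (E : Type u) [Field E] [Algebra F E] (g : G) :
    E ⊗[F] A.carrier →ₐ[E] E ⊗[F] A.carrier :=
  Algebra.TensorProduct.map (AlgHom.id E E) (MulSemiringAction.toAlgHom F A.carrier g)

/-- For two subfields `K`, `F` of `E`: the torsors `B` over `K` and `A` over `F` become isomorphic
(as `G`-torsors) over `E`. -/
def BaseChangeIso {G : Type v} [Group G] {K F : Type u} [Field K] [Field F]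
    (B : GaloisAlgebra G K) (A : GaloisAlgebra G F)
    (E : Type u) [Field E] [Algebra K E] [Algebra F E] : Prop :=
  ∃ e : (E ⊗[K] B.carrier) ≃ₐ[E] (E ⊗[F] A.carrier),
    ∀ (g : G) (x : E ⊗[K] B.carrier), e (baseChangeAct B E g x) = baseChangeAct A E g (e x)

/-- The essential `l`-dimension of a `G`-torsor `A` over a field extension `F` of `k`: the minimal
transcendence degree over `k` of a field `K`, `k ⊆ K ⊆ E`, where `E / F` is finite of degree prime
to `l` and the class of `A` in `H¹(E; G)` lies in the image of `H¹(K; G)`. -/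
def essDimAtTorsor (k : Type u) [Field k] {G : Type v} [Group G] (l : ℕ)
    {F : Type u} [Field F] [Algebra k F] (A : GaloisAlgebra G F) : ℕ∞ :=
  sInf {c : ℕ∞ | ∃ (E : Type u) (_ : Field E) (_ : Algebra k E) (_ : Algebra F E)
    (_ : IsScalarTower k F E) (_ : FiniteDimensional F E) (_ : ¬ l ∣ Module.finrank F E)
    (K : IntermediateField k E) (B : GaloisAlgebra G K),
      BaseChangeIso B A E ∧ c = Cardinal.toENat (Algebra.trdeg k K)}

/-- The essential `l`-dimension `ed_k(G, l)`: the supremum over all field extensions `F / k` and all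
`G`-torsors over `F`. -/
def essDimAt (k : Type u) [Field k] (G : Type v) [Group G] (l : ℕ) : ℕ∞ :=
  sSup {c : ℕ∞ | ∃ (F : Type u) (_ : Field F) (_ : Algebra k F) (A : GaloisAlgebra G F),
    c = essDimAtTorsor k l A}

end EssDim

namespace FiniteOrthogonal

variable {F : Type v} [Field F]

/-- The split form `∑ i, x_i * y_i` on `F ^ (2m)`. -/
def plusForm (F : Type v) [Field F] (m : ℕ) : QuadraticForm F (Fin m ⊕ Fin m → F) :=
  ∑ i : Fin m, QuadraticMap.linMulLin (LinearMap.proj (Sum.inl i)) (LinearMap.proj (Sum.inr i))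

/-- The orthogonal sum on `F ^ (a + 2m)` of a form `N` on `F ^ a` and the split form on
`F ^ (2m)`. -/
def addPlusForm {a : ℕ} (N : QuadraticForm F (Fin a → F)) (m : ℕ) :
    QuadraticForm F (Fin a ⊕ (Fin m ⊕ Fin m) → F) :=
  N.comp (LinearMap.funLeft F F Sum.inl) + (plusForm F m).comp (LinearMap.funLeft F F Sum.inr)

/-- The form `c * z ^ 2 + ∑ i, x_i * y_i` on `F ^ (2m + 1)`. -/
def oddForm (c : F) (m : ℕ) : QuadraticForm F (Fin 1 ⊕ (Fin m ⊕ Fin m) → F) :=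
  addPlusForm (c • QuadraticMap.proj 0 0) m

/-- The form of minus type on `F ^ (2m)`, `1 ≤ m`: the orthogonal sum of `N`, to be taken
anisotropic, on `F ^ 2` and the split form on `F ^ (2m - 2)`. -/
def minusForm (N : QuadraticForm F (Fin 2 → F)) (m : ℕ) :
    QuadraticForm F (Fin 2 ⊕ (Fin (m - 1) ⊕ Fin (m - 1)) → F) :=
  addPlusForm N (m - 1)

variable {ι : Type} [Fintype ι] [DecidableEq ι]

/-- The orthogonal group of a quadratic form on `F ^ ι`, as a group of matrices. -/
def O (Q : QuadraticForm F (ι → F)) : Subgroup (GL ι F) where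
  carrier := {M | ∀ x : ι → F, Q ((M : Matrix ι ι F).mulVec x) = Q x}
  one_mem' := fun x => by simp
  mul_mem' := fun {M N} hM hN x => by
    rw [Units.val_mul, ← Matrix.mulVec_mulVec, hM, hN]
  inv_mem' := fun {M} hM x => by
    rw [← hM, Matrix.mulVec_mulVec, ← Units.val_mul, mul_inv_cancel, Units.val_one,
      Matrix.one_mulVec]

/-- The special orthogonal group: determinant one. -/
def SO (Q : QuadraticForm F (ι → F)) : Subgroup (GL ι F) :=
  O Q ⊓ (Matrix.GeneralLinearGroup.det (n := ι) (R := F)).ker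

/-- The commutator subgroup of the special orthogonal group. -/
def Omega (Q : QuadraticForm F (ι → F)) : Subgroup (GL ι F) := ⁅SO Q, SO Q⁆

/-- The subgroup `{1, -1}` of the general linear group. -/
def signs (F : Type v) [Field F] (ι : Type) [Fintype ι] [DecidableEq ι] : Subgroup (GL ι F) where
  carrier := {M | M = 1 ∨ M = -1}
  one_mem' := Or.inl rfl
  mul_mem' := by rintro _ _ (rfl | rfl) (rfl | rfl) <;> simp
  inv_mem' := by rintro _ (rfl | rfl) <;> simp

instance signs_normal : (signs F ι).Normal where
  conj_mem := by rintro _ (rfl | rfl) g <;> simp [signs]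

/-- `PΩ = Ω / (Ω ∩ {1, -1})`. -/
abbrev POmega (Q : QuadraticForm F (ι → F)) : Type v :=
  Omega Q ⧸ (signs F ι).subgroupOf (Omega Q)

end FiniteOrthogonal

end

/-!
If a homomorphism `H → G` of finite groups is injective on a Sylow `l`-subgroup and maps it onto a
Sylow `l`-subgroup of `G`, then `H` and `G` have the same essential `l`-dimension: every `G`-torsor
reduces to a Sylow `l`-subgroup over an extension of degree prime to `l`. For a subgroup the
condition says that the two orders have the same `l`-part.

The orders of the orthogonal groups come from counting singular vectors, splitting off one
hyperbolic plane at a time. Comparing `l`-parts, the inclusions `O(n, q) ≤ GL_n`, the embeddings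
`M ↦ diag(M, M⁻ᵀ)` of `GL_m` and the inclusions obtained by adding a hyperbolic plane give every
case of the formula. Finally, isometry groups are generated by reflections and elements of `p`-power
order, so for `l ≠ 2, p` the index of `Ω` in `SO` is prime to `l`, and passing to `PΩ` only kills
signs.
-/

noncomputable section

namespace EssDim

/-- Dual families for an action of `G` on `A`: `∑ i, a i * g • b i` is `1` for `g = 1` and `0` for
`g ≠ 1`. -/
structure IsGaloisDual (G : Type*) [Group G] {A ι : Type*} [CommRing A] [MulSemiringAction G A]
    [Fintype ι] (a b : ι → A) : Prop where
  sum_mul : ∑ i, a i * b i = 1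
  sum_mul_smul : ∀ g : G, g ≠ 1 → ∑ i, a i * g • b i = 0

/-- The Chase–Harrison–Rosenberg description of a Galois algebra: the invariants are the base and
there are dual families. -/
structure IsGaloisAction (G : Type*) [Group G] (F : Type*) [CommRing F] (A : Type*) [CommRing A]
    [Algebra F A] [MulSemiringAction G A] : Prop extends Algebra.IsInvariant F A G where
  exists_dual : ∃ (n : ℕ) (a b : Fin n → A), IsGaloisDual G a b

section Dual

lemma smul_sum_smul {G M : Type*} [Group G] [Fintype G] [AddCommMonoid M] [DistribMulAction G M]
    (h : G) (x : M) : h • ∑ g : G, g • x = ∑ g : G, g • x := by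
  simp only [Finset.smul_sum, smul_smul]
  exact Fintype.sum_equiv (Equiv.mulLeft h) _ _ fun _ => rfl

variable {G : Type*} [Group G] {A ι : Type*} [CommRing A] [MulSemiringAction G A] [Fintype ι]
  {a b : ι → A}

lemma IsGaloisDual.symm (h : IsGaloisDual G a b) : IsGaloisDual G b a where
  sum_mul := by simpa only [mul_comm] using h.sum_mul
  sum_mul_smul g hg := by
    have := congrArg (g • ·) (h.sum_mul_smul g⁻¹ (inv_ne_one.mpr hg))
    simpa only [Finset.smul_sum, smul_mul', smul_inv_smul, smul_zero, mul_comm] using this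

lemma IsGaloisDual.map (hab : IsGaloisDual G a b) {H : Type*} [Group H] {f : H →* G}
    (hf : Function.Injective f) {B : Type*} [CommRing B] [MulSemiringAction H B] (φ : A →+* B)
    (hφ : ∀ (h : H) (x : A), φ (f h • x) = h • φ x) :
    IsGaloisDual H (fun i => φ (a i)) (fun i => φ (b i)) where
  sum_mul := by simpa only [map_sum, map_mul, map_one] using congrArg φ hab.sum_mul
  sum_mul_smul h hh := by
    simpa only [map_sum, map_mul, map_zero, hφ] using
      congrArg φ (hab.sum_mul_smul (f h) ((map_ne_one_iff f hf).mpr hh))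

lemma IsGaloisDual.exists_fin (h : IsGaloisDual G a b) :
    ∃ (n : ℕ) (a' b' : Fin n → A), IsGaloisDual G a' b' := by
  let e := (Fintype.equivFin ι).symm
  exact ⟨_, a ∘ e, b ∘ e, (e.sum_comp fun i => a i * b i).trans h.sum_mul,
    fun g hg => (e.sum_comp fun i => a i * g • b i).trans (h.sum_mul_smul g hg)⟩

lemma IsGaloisDual.sum_smul_mul_smul [DecidableEq G] (h : IsGaloisDual G a b) (g g' : G) :
    ∑ i, g • a i * g' • b i = if g = g' then 1 else 0 := by
  have hfactor (i : ι) : g • a i * g' • b i = g • (a i * (g⁻¹ * g') • b i) := by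
    rw [smul_mul', smul_smul, mul_inv_cancel_left]
  simp_rw [hfactor]
  rw [← Finset.smul_sum]
  split_ifs with hg
  · subst hg
    simp only [inv_mul_cancel, one_smul, h.sum_mul, smul_one]
  · rw [h.sum_mul_smul _ (inv_mul_eq_one.not.mpr hg), smul_zero]

lemma IsGaloisDual.sum_mul_trace [Fintype G] (h : IsGaloisDual G a b) (x : A) :
    ∑ i, a i * ∑ g : G, g • (b i * x) = x := by
  simp_rw [Finset.mul_sum]
  rw [Finset.sum_comm, Finset.sum_eq_single_of_mem (1 : G) (Finset.mem_univ _)]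
  · simp_rw [one_smul, ← mul_assoc]
    rw [← Finset.sum_mul, h.sum_mul, one_mul]
  · intro g _ hg
    simp_rw [smul_mul', ← mul_assoc]
    rw [← Finset.sum_mul, h.sum_mul_smul g hg, zero_mul]

end Dual

section CommRing

variable {G : Type*} [Group G] {F : Type*} [CommRing F] {A : Type*} [CommRing A] [Algebra F A]
  [MulSemiringAction G A]

lemma IsGaloisAction.exists_trace [Fintype G] (hA : IsGaloisAction G F A) (x : A) :
    ∃ c : F, algebraMap F A c = ∑ g : G, g • x :=
  hA.isInvariant _ fun g => smul_sum_smul g x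

lemma IsGaloisAction.finite [Finite G] (hA : IsGaloisAction G F A) : Module.Finite F A := by
  cases nonempty_fintype G
  obtain ⟨n, a, b, hab⟩ := hA.exists_dual
  refine ⟨⟨(Set.finite_range a).toFinset, ?_⟩⟩
  rw [Set.Finite.coe_toFinset, eq_top_iff]
  intro x _
  rw [← hab.sum_mul_trace x]
  refine Submodule.sum_mem _ fun i _ => ?_
  obtain ⟨c, hc⟩ := hA.exists_trace (b i * x)
  rw [← hc, mul_comm, ← Algebra.smul_def]
  exact Submodule.smul_mem _ _ (Submodule.subset_span ⟨i, rfl⟩)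

lemma IsGaloisAction.eq_bot_of_stable [Finite G] (hA : IsGaloisAction G F A) (I : Ideal A)
    (hI : ∀ (g : G), ∀ x ∈ I, g • x ∈ I)
    (hscalar : ∀ c : F, algebraMap F A c ∈ I → algebraMap F A c = 0) : I = ⊥ := by
  cases nonempty_fintype G
  obtain ⟨n, a, b, hab⟩ := hA.exists_dual
  refine (Submodule.eq_bot_iff I).mpr fun x hx => ?_
  rw [← hab.sum_mul_trace x]
  refine Finset.sum_eq_zero fun i _ => ?_
  obtain ⟨c, hc⟩ := hA.exists_trace (b i * x)
  have htrace : ∑ g : G, g • (b i * x) ∈ I := I.sum_mem fun g _ => hI g _ (I.mul_mem_left _ hx)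
  rw [← hc] at htrace ⊢
  rw [hscalar c htrace, mul_zero]

end CommRing

section Field

variable {G : Type*} [Group G] {F : Type*} [Field F] {A : Type*} [CommRing A] [Algebra F A]
  [MulSemiringAction G A]

lemma IsGaloisAction.eq_bot_of_stable_of_ne_top [Finite G] (hA : IsGaloisAction G F A)
    (I : Ideal A) (hI : ∀ (g : G), ∀ x ∈ I, g • x ∈ I) (hne : I ≠ ⊤) : I = ⊥ := by
  refine hA.eq_bot_of_stable I hI fun c hc => ?_
  by_contra h0
  have hunit : IsUnit c := .mk0 c (by rintro rfl; exact h0 (map_zero _))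
  exact hne (I.eq_top_of_isUnit_mem hc (hunit.map _))

lemma IsGaloisAction.exists_trace_eq_one [Fintype G] [Nontrivial A] (hA : IsGaloisAction G F A)
    [SMulCommClass G F A] : ∃ x : A, ∑ g : G, g • x = 1 := by
  obtain ⟨n, a, b, hab⟩ := hA.exists_dual
  by_contra! hne
  refine one_ne_zero (α := A) ?_
  rw [← hab.sum_mul_trace 1]
  refine Finset.sum_eq_zero fun i _ => ?_
  obtain ⟨c, hc⟩ := hA.exists_trace (b i * 1)
  by_cases hc0 : c = 0
  · rw [← hc, hc0, map_zero, mul_zero]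
  · refine absurd ?_ (hne (c⁻¹ • (b i * 1)))
    simp_rw [smul_comm _ c⁻¹]
    rw [← Finset.smul_sum, ← hc, Algebra.smul_def, ← map_mul, inv_mul_cancel₀ hc0, map_one]

theorem IsGaloisAction.bijective_of_equivariant [Finite G] {B : Type*} [CommRing B] [Nontrivial B]
    [Algebra F B] [MulSemiringAction G B] (hA : IsGaloisAction G F A) (hB : IsGaloisAction G F B)
    (φ : A →ₐ[F] B) (hφ : ∀ (g : G) (x : A), φ (g • x) = g • φ x) : Function.Bijective φ := by
  cases nonempty_fintype G
  constructor
  · rw [injective_iff_map_eq_zero]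
    have hbot := hA.eq_bot_of_stable_of_ne_top (RingHom.ker φ)
      (fun g x hx => by rw [RingHom.mem_ker] at hx ⊢; rw [hφ, hx, smul_zero])
      (RingHom.ker_ne_top φ)
    exact fun x hx => hbot.le hx
  · intro y
    obtain ⟨n, a, b, hab⟩ := hA.exists_dual
    rw [← (hab.map (f := .id G) Function.injective_id φ.toRingHom hφ).sum_mul_trace y]
    change _ ∈ φ.range
    refine sum_mem fun i _ => mul_mem ⟨a i, rfl⟩ ?_
    obtain ⟨c, hc⟩ := hB.exists_trace (φ.toRingHom (b i) * y)
    rw [← hc]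
    exact φ.range.algebraMap_mem c

end Field

section Torsor

variable {G : Type v} [Group G] {F : Type u} [Field F] {A : Type u} [CommRing A] [Algebra F A]
  [MulSemiringAction G A] [SMulCommClass G F A]

lemma torsorMap_tmul (x y : A) (g : G) : torsorMap G F A (x ⊗ₜ y) g = x * g • y := by
  simp [torsorMap]

lemma mem_range_algebraMap_of_tmul_one_eq {F A : Type*} [Field F] [CommRing A] [Algebra F A]
    [Nontrivial A] {a : A} (h : a ⊗ₜ[F] (1 : A) = 1 ⊗ₜ a) : ∃ c : F, algebraMap F A c = a := by
  obtain ⟨f, hf⟩ := Module.Projective.exists_dual_eq_one F (one_ne_zero (α := A))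
  refine ⟨f a, ?_⟩
  have := congrArg (TensorProduct.lid F A ∘ₗ f.rTensor A : A ⊗[F] A →ₗ[F] A) h
  simpa [hf, Algebra.algebraMap_eq_smul_one] using this

-- A preimage of the indicator of `1` under the torsor map is a pair of dual families.
lemma exists_isGaloisDual (h : Function.Surjective (torsorMap G F A)) :
    ∃ (n : ℕ) (a b : Fin n → A), IsGaloisDual G a b := by
  classical
  obtain ⟨t, ht⟩ := h (Pi.single 1 1)
  obtain ⟨S, hS⟩ := TensorProduct.exists_finset t
  let pair (i : Fin S.card) : A × A := (S.equivFin.symm i).1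
  have hpair (g : G) : ∑ i, (pair i).1 * g • (pair i).2 = (Pi.single 1 1 : G → A) g := by
    rw [← ht, hS, map_sum, Finset.sum_apply, ← Finset.sum_coe_sort S]
    simp_rw [torsorMap_tmul]
    exact Fintype.sum_equiv S.equivFin.symm _ _ fun _ => rfl
  exact ⟨S.card, fun i => (pair i).1, fun i => (pair i).2,
    by simpa using hpair 1, fun g hg => by simpa [hg] using hpair g⟩

lemma isGaloisAction_of_bijective [Nontrivial A]
    (h : Function.Bijective (torsorMap G F A)) : IsGaloisAction G F A where
  isInvariant a ha := by
    refine mem_range_algebraMap_of_tmul_one_eq (h.1 ?_)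
    ext g
    simp [torsorMap_tmul, ha g]
  exists_dual := exists_isGaloisDual h.2

lemma IsGaloisAction.sum_torsorMap_tmul [Fintype G] (hA : IsGaloisAction G F A) {ι : Type*}
    [Fintype ι] {a b : ι → A} (hab : IsGaloisDual G a b) (t : A ⊗[F] A) :
    ∑ g : G, ∑ i, (torsorMap G F A t g * g • a i) ⊗ₜ[F] b i = t := by
  induction t using TensorProduct.induction_on with
  | zero => simp
  | add x y hx hy =>
    simp_rw [map_add, Pi.add_apply, add_mul, TensorProduct.add_tmul, Finset.sum_add_distrib]
    rw [hx, hy]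
  | tmul x y =>
    have htrace (i : ι) : ∑ g : G, (x * g • y * g • a i) ⊗ₜ[F] b i =
        x ⊗ₜ (b i * ∑ g : G, g • (a i * y)) := by
      obtain ⟨c, hc⟩ := hA.exists_trace (a i * y)
      simp_rw [mul_assoc, ← smul_mul', mul_comm y]
      rw [← TensorProduct.sum_tmul, ← Finset.mul_sum, ← hc, mul_comm x, ← Algebra.smul_def,
        TensorProduct.smul_tmul, Algebra.smul_def, mul_comm]
    simp_rw [torsorMap_tmul]
    rw [Finset.sum_comm]
    simp_rw [htrace]
    rw [← TensorProduct.tmul_sum, hab.symm.sum_mul_trace]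

lemma IsGaloisAction.torsorMap_bijective [Finite G] (hA : IsGaloisAction G F A) :
    Function.Bijective (torsorMap G F A) := by
  cases nonempty_fintype G
  obtain ⟨n, a, b, hab⟩ := hA.exists_dual
  refine ⟨fun s t hst => ?_, fun c => ⟨∑ g : G, ∑ i, (c g * a i) ⊗ₜ (g⁻¹ • b i), ?_⟩⟩
  · rw [← hA.sum_torsorMap_tmul hab s, hst, hA.sum_torsorMap_tmul hab]
  · ext h
    simp_rw [map_sum, Finset.sum_apply, torsorMap_tmul, smul_smul, mul_assoc, ← Finset.mul_sum]
    rw [Finset.sum_eq_single_of_mem h (Finset.mem_univ _)]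
    · simp [hab.sum_mul]
    · intro g _ hg
      rw [hab.sum_mul_smul _ (by rwa [ne_eq, mul_inv_eq_one, eq_comm]), mul_zero]

lemma IsGaloisAction.finrank_eq [Finite G] [Nontrivial A] (hA : IsGaloisAction G F A) :
    Module.finrank F A = Nat.card G := by
  have := Fintype.ofFinite G
  have := hA.finite
  have h := (LinearEquiv.ofBijective (torsorMap G F A).toLinearMap
    hA.torsorMap_bijective).finrank_eq
  rw [Module.finrank_tensorProduct, Module.finrank_pi_fintype, Finset.sum_const,
    Finset.card_univ, smul_eq_mul, ← Nat.card_eq_fintype_card] at h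
  exact Nat.eq_of_mul_eq_mul_right Module.finrank_pos h

lemma GaloisAlgebra.isGaloisAction (A : GaloisAlgebra G F) :
    IsGaloisAction G F A.carrier :=
  have := A.nontrivial
  isGaloisAction_of_bijective A.bijective

/-- The Galois algebra given by a Galois action. -/
def IsGaloisAction.toGaloisAlgebra [Finite G] [Nontrivial A] (hA : IsGaloisAction G F A) :
    GaloisAlgebra G F where
  carrier := A
  nontrivial := inferInstance
  bijective := hA.torsorMap_bijective

end Torsor

section BaseChange

section Action

variable {G : Type*} [Group G] {F : Type*} [CommRing F] {A : Type*} [CommRing A] [Algebra F A]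
  [MulSemiringAction G A] [SMulCommClass G F A] {E : Type*} [CommRing E] [Algebra F E]

/-- The action on the base change `E ⊗[F] A` through the second factor. -/
instance baseChangeAction : MulSemiringAction G (E ⊗[F] A) where
  smul g := Algebra.TensorProduct.map (AlgHom.id E E) (MulSemiringAction.toAlgHom F A g)
  one_smul x := by
    change Algebra.TensorProduct.map (AlgHom.id E E) (MulSemiringAction.toAlgHom F A 1) x = x
    have hone : MulSemiringAction.toAlgHom F A (1 : G) = AlgHom.id F A := by ext; simp
    rw [hone, Algebra.TensorProduct.map_id, AlgHom.id_apply]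
  mul_smul g h x := by
    change Algebra.TensorProduct.map (AlgHom.id E E) (MulSemiringAction.toAlgHom F A (g * h)) x =
      Algebra.TensorProduct.map (AlgHom.id E E) (MulSemiringAction.toAlgHom F A g)
        (Algebra.TensorProduct.map (AlgHom.id E E) (MulSemiringAction.toAlgHom F A h) x)
    induction x using TensorProduct.induction_on with
    | zero => simp
    | tmul x y => simp [mul_smul]
    | add x y hx hy => simp only [map_add, hx, hy]
  smul_zero _ := map_zero _
  smul_add _ := map_add _
  smul_one _ := map_one _
  smul_mul _ := map_mul _

lemma smul_baseChange_tmul (g : G) (e : E) (a : A) : g • (e ⊗ₜ[F] a) = e ⊗ₜ[F] (g • a) := rfl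

instance baseChange_smulCommClass : SMulCommClass G E (E ⊗[F] A) where
  smul_comm g :=
    map_smul (Algebra.TensorProduct.map (AlgHom.id E E) (MulSemiringAction.toAlgHom F A g))

lemma exists_trace_baseChange [Fintype G] (hA : IsGaloisAction G F A) (y : E ⊗[F] A) :
    ∃ e : E, algebraMap E _ e = ∑ g : G, g • y := by
  induction y using TensorProduct.induction_on with
  | zero => exact ⟨0, by simp⟩
  | tmul e a =>
    obtain ⟨t, ht⟩ := hA.exists_trace a
    refine ⟨t • e, ?_⟩
    simp_rw [smul_baseChange_tmul]
    rw [← TensorProduct.tmul_sum, ← ht, Algebra.TensorProduct.algebraMap_apply,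
      Algebra.algebraMap_self_apply, Algebra.algebraMap_eq_smul_one (A := A),
      TensorProduct.tmul_smul, TensorProduct.smul_tmul']
  | add x y hx hy =>
    obtain ⟨s, hs⟩ := hx
    obtain ⟨t, ht⟩ := hy
    exact ⟨s + t, by simp_rw [map_add, hs, ht, smul_add, Finset.sum_add_distrib]⟩

end Action

variable {G : Type*} [Group G] [Finite G] {F : Type*} [Field F] {A : Type*} [CommRing A]
  [Nontrivial A] [Algebra F A] [MulSemiringAction G A] [SMulCommClass G F A]

lemma IsGaloisAction.baseChange {E : Type*} [CommRing E] [Algebra F E]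
    (hA : IsGaloisAction G F A) : IsGaloisAction G E (E ⊗[F] A) where
  isInvariant x hx := by
    cases nonempty_fintype G
    obtain ⟨c, hc⟩ := hA.exists_trace_eq_one
    obtain ⟨e, he⟩ := exists_trace_baseChange hA (x * 1 ⊗ₜ c)
    refine ⟨e, he.trans ?_⟩
    simp_rw [smul_mul', hx, smul_baseChange_tmul]
    rw [← Finset.mul_sum, ← TensorProduct.tmul_sum, hc]
    exact mul_one x
  exists_dual := by
    obtain ⟨n, a, b, hab⟩ := hA.exists_dual
    exact ⟨n, _, _, hab.map (f := .id G) Function.injective_id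
      (Algebra.TensorProduct.includeRight : A →ₐ[F] E ⊗[F] A).toRingHom fun _ _ => rfl⟩

end BaseChange

section TorsorHom

/-- For `G` acting on the `F`-algebra `A`, `H` acting on the `E`-algebra `T`, an `F`-algebra `E` and
`f : H →* G`: the homomorphism `ψ : A →+* T` covers `F → E` and is equivariant along `f`, so that,
for torsors, it exhibits `T` as a reduction of `E ⊗[F] A` to `H`. -/
structure IsTorsorHom {G H : Type*} [Group G] [Group H] (f : H →* G) (F E : Type*) [CommRing F]
    [CommRing E] [Algebra F E] {A T : Type*} [CommRing A] [CommRing T] [Algebra F A] [Algebra E T]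
    [MulSemiringAction G A] [MulSemiringAction H T] (ψ : A →+* T) : Prop where
  map_algebraMap : ∀ c : F, ψ (algebraMap F A c) = algebraMap E T (algebraMap F E c)
  map_smul : ∀ (h : H) (x : A), ψ (f h • x) = h • ψ x

section

variable {G H : Type*} [Group G] [Group H] {f : H →* G} {F E : Type*} [CommRing F] [CommRing E]
  [Algebra F E] {A T : Type*} [CommRing A] [CommRing T] [Algebra F A] [Algebra E T]
  [MulSemiringAction G A] [MulSemiringAction H T]

lemma IsTorsorHom.comp {H' : Type*} [Group H'] {f' : H' →* H} {E' : Type*} [CommRing E']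
    [Algebra F E'] [Algebra E E'] [IsScalarTower F E E'] {T' : Type*} [CommRing T'] [Algebra E' T']
    [MulSemiringAction H' T'] {ψ : A →+* T} {ψ' : T →+* T'} (hψ' : IsTorsorHom f' E E' ψ')
    (hψ : IsTorsorHom f F E ψ) : IsTorsorHom (f.comp f') F E' (ψ'.comp ψ) where
  map_algebraMap c := by
    rw [RingHom.comp_apply, hψ.map_algebraMap, hψ'.map_algebraMap,
      ← IsScalarTower.algebraMap_apply F E E']
  map_smul h x := by
    simp only [RingHom.comp_apply, MonoidHom.comp_apply, hψ.map_smul, hψ'.map_smul]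

lemma isTorsorHom_includeRight [SMulCommClass G F A] :
    IsTorsorHom (.id G) F E
      (Algebra.TensorProduct.includeRight : A →ₐ[F] E ⊗[F] A).toRingHom where
  map_algebraMap c := (Algebra.TensorProduct.includeRight (R := F) (A := E)).commutes c
  map_smul _ _ := rfl

/-- The extension of scalars `E ⊗[F] A → T` of a homomorphism over `F → E`. -/
def IsTorsorHom.lift {ψ : A →+* T} (hψ : IsTorsorHom f F E ψ) : E ⊗[F] A →ₐ[E] T :=
  let _ : Algebra F T := ((algebraMap E T).comp (algebraMap F E)).toAlgebra
  have : IsScalarTower F E T := .of_algebraMap_eq fun _ => rfl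
  Algebra.TensorProduct.lift (Algebra.ofId E T) { ψ with commutes' := hψ.map_algebraMap }
    fun _ _ => Commute.all _ _

lemma IsTorsorHom.lift_tmul {ψ : A →+* T} (hψ : IsTorsorHom f F E ψ) (e : E) (a : A) :
    hψ.lift (e ⊗ₜ a) = algebraMap E T e * ψ a := rfl

lemma IsTorsorHom.isTorsorHom_lift [SMulCommClass G F A] [SMulCommClass H E T] {ψ : A →+* T}
    (hψ : IsTorsorHom f F E ψ) : IsTorsorHom f E E hψ.lift.toRingHom where
  map_algebraMap := hψ.lift.commutes
  map_smul h x := by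
    change hψ.lift (f h • x) = h • hψ.lift x
    induction x using TensorProduct.induction_on with
    | zero => simp only [smul_zero, map_zero]
    | tmul e a =>
      rw [smul_baseChange_tmul, lift_tmul, lift_tmul, smul_mul', smul_algebraMap, hψ.map_smul]
    | add x y hx hy => simp only [smul_add, map_add, hx, hy]

end

variable {G : Type v} [Group G] {K F E : Type u} [Field K] [Field F] [Field E] [Algebra K E]
  [Algebra F E] {B : GaloisAlgebra G K} {A : GaloisAlgebra G F}

lemma BaseChangeIso.exists_isTorsorHom (h : BaseChangeIso B A E) :
    ∃ ψ : B.carrier →+* E ⊗[F] A.carrier, IsTorsorHom (.id G) K E ψ := by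
  obtain ⟨e, he⟩ := h
  have he' : IsTorsorHom (.id G) E E (e : E ⊗[K] B.carrier →ₐ[E] E ⊗[F] A.carrier).toRingHom :=
    ⟨e.commutes, he⟩
  exact ⟨_, he'.comp isTorsorHom_includeRight⟩

theorem IsGaloisAction.baseChangeIso [Finite G] {T : Type*} [CommRing T] [Nontrivial T]
    [Algebra E T] [MulSemiringAction G T] [SMulCommClass G E T] (hT : IsGaloisAction G E T)
    {β : B.carrier →+* T} (hβ : IsTorsorHom (.id G) K E β) {α : A.carrier →+* T}
    (hα : IsTorsorHom (.id G) F E α) : BaseChangeIso B A E := by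
  have := A.nontrivial
  have := B.nontrivial
  let eA := AlgEquiv.ofBijective hα.lift
    (A.isGaloisAction.baseChange.bijective_of_equivariant hT _ hα.isTorsorHom_lift.map_smul)
  let eB := AlgEquiv.ofBijective hβ.lift
    (B.isGaloisAction.baseChange.bijective_of_equivariant hT _ hβ.isTorsorHom_lift.map_smul)
  refine ⟨eB.trans eA.symm, fun g x => eA.injective ?_⟩
  calc eA (eA.symm (eB (g • x))) = g • eA (eA.symm (eB x)) := by
        rw [eA.apply_symm_apply, eA.apply_symm_apply]
        exact hβ.isTorsorHom_lift.map_smul g x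
    _ = eA (g • eA.symm (eB x)) := (hα.isTorsorHom_lift.map_smul g _).symm

end TorsorHom

section Induced

variable {G H : Type*} [Group G] [Group H] (f : H →* G) (F : Type*) [CommRing F] (R : Type*)
  [CommRing R] [Algebra F R] [MulSemiringAction H R] [SMulCommClass H F R]

/-- The algebra induced along `f : H →* G` from an algebra with an action of `H`, realized as the
functions `φ : G → R` with `φ (f h * g) = h • φ g`; the group `G` acts by right translations. -/
def Ind : Subalgebra F (G → R) where
  carrier := {φ | ∀ h g, φ (f h * g) = h • φ g}
  mul_mem' := fun {x y} hx hy h g => by simp [hx h g, hy h g]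
  add_mem' := fun {x y} hx hy h g => by simp [hx h g, hy h g]
  algebraMap_mem' := fun c h g => by simp

variable {f F R}

lemma Ind.ext {x y : Ind f F R} (h : ∀ g, x.1 g = y.1 g) : x = y := Subtype.ext (funext h)

lemma Ind.sum_apply {ι : Type*} (s : Finset ι) (x : ι → Ind f F R) (g : G) :
    (∑ i ∈ s, x i).1 g = ∑ i ∈ s, (x i).1 g := by
  rw [AddSubmonoidClass.coe_finsetSum, Finset.sum_apply]

instance : MulSemiringAction G (Ind f F R) where
  smul g x := ⟨fun y => x.1 (y * g), fun h y => by simpa only [mul_assoc] using x.2 h (y * g)⟩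
  one_smul x := Ind.ext fun y => congrArg x.1 (mul_one y)
  mul_smul g h x := Ind.ext fun y => congrArg x.1 (mul_assoc y g h).symm
  smul_zero _ := rfl
  smul_add _ _ _ := rfl
  smul_one _ := rfl
  smul_mul _ _ _ := rfl

lemma Ind.smul_apply (g : G) (x : Ind f F R) (y : G) : (g • x).1 y = x.1 (y * g) := rfl

instance : SMulCommClass G F (Ind f F R) where
  smul_comm _ _ _ := rfl

variable (f F R) in
/-- Evaluation at `1`, the counit of the adjunction between restriction and induction. -/
def Ind.eval : Ind f F R →ₐ[F] R := (Pi.evalAlgHom F (fun _ : G => R) 1).comp (Ind f F R).val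

lemma Ind.isTorsorHom_eval : IsTorsorHom f F F (Ind.eval f F R).toRingHom where
  map_algebraMap := (Ind.eval f F R).commutes
  map_smul h x := by
    change x.1 (1 * f h) = h • x.1 1
    rw [one_mul, ← x.2 h 1, mul_one]

/-- The `G`-equivariant map to the induced algebra adjoint to an `H`-equivariant map. -/
def Ind.lift {P : Type*} [CommRing P] [MulSemiringAction G P] (φ : P →+* R)
    (hφ : ∀ h x, φ (f h • x) = h • φ x) : P →+* Ind f F R :=
  RingHom.codRestrict (RingHom.pi fun g : G => φ.comp (MulSemiringAction.toRingHom G P g))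
    (Ind f F R) fun x h g => by
      change φ ((f h * g) • x) = h • φ (g • x)
      rw [mul_smul, hφ]

lemma Ind.isTorsorHom_lift {K P : Type*} [CommRing K] [Algebra K F] [CommRing P] [Algebra K P]
    [MulSemiringAction G P] [SMulCommClass G K P] {φ : P →+* R} (hφ : IsTorsorHom f K F φ) :
    IsTorsorHom (.id G) K F (Ind.lift (F := F) φ hφ.map_smul) where
  map_algebraMap c := Ind.ext fun g => by
    change φ (g • algebraMap K P c) = _
    rw [smul_algebraMap]
    exact hφ.map_algebraMap c
  map_smul g x := Ind.ext fun y => congrArg φ (smul_smul y g x)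

instance [Nontrivial R] : Nontrivial (Ind f F R) := (Ind.eval f F R).toRingHom.domain_nontrivial

-- Write `x = f h * t` with `t` a fixed representative of the coset of `x`, and send `x` to `h`.
lemma exists_equivariant_map (hf : Function.Injective f) :
    ∃ σ : G → H, ∀ h x, σ (f h * x) = h * σ x := by
  let τ (x : G) : G := (Quotient.mk (QuotientGroup.rightRel f.range) x).out
  have hτ (h : H) (x : G) : τ (f h * x) = τ x :=
    congrArg Quotient.out (Quotient.sound (QuotientGroup.rightRel_apply.mpr ⟨h⁻¹, by simp⟩))
  have hσ (x : G) : ∃ h, f h * τ x = x := by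
    obtain ⟨h, hh⟩ := QuotientGroup.rightRel_apply.mp
      (Quotient.mk_out (s := QuotientGroup.rightRel f.range) x)
    exact ⟨h, by rw [hh, inv_mul_cancel_right]⟩
  choose σ hσ using hσ
  refine ⟨σ, fun h x => hf (mul_right_cancel (b := τ x) ?_)⟩
  rw [map_mul, mul_assoc, hσ x, ← hτ h x, hσ]

variable {σ : G → H}

lemma inv_apply_mul_apply_mul (hσ : ∀ h x, σ (f h * x) = h * σ x) (h : H) (x : G) :
    (f (σ (f h * x)))⁻¹ * (f h * x) = (f (σ x))⁻¹ * x := by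
  rw [hσ, map_mul]
  group

open Classical in
variable (F) in
/-- For an `H`-equivariant `σ : G → H`, whose fibre over `1` represents the cosets of `H`: the
element of the induced algebra supported on the coset of the representative `t` and equal to `r`
at `t`. -/
def Ind.single (hσ : ∀ h x, σ (f h * x) = h * σ x) (t : G) (r : R) : Ind f F R :=
  ⟨fun x => if (f (σ x))⁻¹ * x = t then σ x • r else 0, fun h x => by
    dsimp only
    rw [inv_apply_mul_apply_mul hσ, hσ, mul_smul]
    split_ifs <;> simp⟩

variable (hσ : ∀ h x, σ (f h * x) = h * σ x)
include hσ

open Classical in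
lemma Ind.single_apply (t : G) (r : R) (x : G) :
    (Ind.single F hσ t r).1 x = if (f (σ x))⁻¹ * x = t then σ x • r else 0 := rfl

open Classical in
lemma Ind.sum_single_mul_single [Fintype G] {ι : Type*} [Fintype ι] {a b : ι → R}
    (hab : IsGaloisDual H a b) (x y : G) :
    ∑ i : G × ι, (Ind.single F hσ i.1 (a i.2)).1 x * (Ind.single F hσ i.1 (b i.2)).1 y =
      if x = y then 1 else 0 := by
  rw [Fintype.sum_prod_type]
  simp_rw [Ind.single_apply]
  rw [Finset.sum_eq_single_of_mem ((f (σ x))⁻¹ * x) (Finset.mem_univ _)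
    fun t _ ht => by simp [ht.symm]]
  by_cases hxy : (f (σ y))⁻¹ * y = (f (σ x))⁻¹ * x
  · have hiff : σ x = σ y ↔ x = y :=
      ⟨fun h => by rw [h] at hxy; exact (mul_left_cancel hxy).symm, congrArg σ⟩
    simp only [hxy, if_true, hab.sum_smul_mul_smul, hiff]
  · rw [if_neg (by rintro rfl; exact hxy rfl)]
    simp only [hxy, if_false, mul_zero, Finset.sum_const_zero]

lemma IsGaloisDual.ind [Fintype G] {ι : Type*} [Fintype ι] {a b : ι → R}
    (hab : IsGaloisDual H a b) :
    IsGaloisDual G (fun i : G × ι => Ind.single F hσ i.1 (a i.2))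
      (fun i => Ind.single F hσ i.1 (b i.2)) where
  sum_mul := Ind.ext fun x => by
    rw [Ind.sum_apply]
    exact (Ind.sum_single_mul_single hσ hab x x).trans (if_pos rfl)
  sum_mul_smul g hg := Ind.ext fun x => by
    rw [Ind.sum_apply]
    exact (Ind.sum_single_mul_single hσ hab x (x * g)).trans
      (if_neg (fun h => hg (left_eq_mul.mp h)))

omit hσ in
theorem IsGaloisAction.ind [Finite G] (hf : Function.Injective f) (hR : IsGaloisAction H F R) :
    IsGaloisAction G F (Ind f F R) where
  isInvariant x hx := by
    have hconst (g : G) : x.1 g = x.1 1 := by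
      rw [← congrArg (fun y : Ind f F R => y.1 1) (hx g), Ind.smul_apply, one_mul]
    obtain ⟨c, hc⟩ := hR.isInvariant (x.1 1) fun h => by rw [← x.2 h 1, hconst]
    exact ⟨c, Ind.ext fun g => hc.trans (hconst g).symm⟩
  exists_dual := by
    cases nonempty_fintype G
    obtain ⟨σ, hσ⟩ := exists_equivariant_map hf
    obtain ⟨n, a, b, hab⟩ := hR.exists_dual
    exact (hab.ind hσ).exists_fin

end Induced

section Descent

section ScalarField

variable {K E : Type*} [Field K] [Field E] [Algebra K E] {T : Type*} [CommRing T] [Nontrivial T]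
  [Algebra K T] [Algebra E T] [IsScalarTower K E T] (S : Subalgebra K T)

section Field

variable [FiniteDimensional K S]

variable (E) in
/-- The scalars of `E` in a finite-dimensional `K`-subalgebra of an `E`-algebra. -/
def scalarField : IntermediateField K E :=
  (S.comap (IsScalarTower.toAlgHom K E T)).toIntermediateField fun x hx => by
    let S' := S.comap (IsScalarTower.toAlgHom K E T)
    let ι : S' →ₗ[K] S := LinearMap.restrict (IsScalarTower.toAlgHom K E T).toLinearMap
      (p := S'.toSubmodule) (q := S.toSubmodule) fun _ h => h
    have : FiniteDimensional K S' := .of_injective ι fun a b hab =>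
      Subtype.ext ((algebraMap E T).injective (congrArg Subtype.val hab))
    exact S'.inv_mem_of_algebraic (x := ⟨x, hx⟩)
      (Algebra.IsAlgebraic.isAlgebraic (R := K) (⟨x, hx⟩ : S')).algebraMap

instance : Algebra (scalarField E S) S :=
  (((algebraMap E T).comp (algebraMap (scalarField E S) E)).codRestrict S.toSubring
    fun c => c.2).toAlgebra

instance : IsScalarTower K (scalarField E S) S :=
  .of_algebraMap_eq fun c => Subtype.ext (IsScalarTower.algebraMap_apply K E T c)

end Field

variable {H : Type*} [Group H] [MulSemiringAction H T]

/-- The action on a stable subalgebra. -/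
@[reducible] def stableAction (hS : ∀ (h : H), ∀ x ∈ S, h • x ∈ S) : MulSemiringAction H S where
  smul h x := ⟨h • x.1, hS h x x.2⟩
  one_smul _ := Subtype.ext (one_smul _ _)
  mul_smul _ _ _ := Subtype.ext (mul_smul _ _ _)
  smul_zero _ := Subtype.ext (smul_zero _)
  smul_add _ _ _ := Subtype.ext (smul_add _ _ _)
  smul_one _ := Subtype.ext (smul_one _)
  smul_mul _ _ _ := Subtype.ext (smul_mul' _ _ _)

lemma isInvariant_scalarField [FiniteDimensional K S] [Algebra.IsInvariant E T H]
    (hS : ∀ (h : H), ∀ x ∈ S, h • x ∈ S) :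
    letI := stableAction S hS
    Algebra.IsInvariant (scalarField E S) S H :=
  letI := stableAction S hS
  ⟨fun a ha => by
    obtain ⟨c, hc⟩ := Algebra.IsInvariant.isInvariant (A := E) a.1
      fun h : H => congrArg Subtype.val (ha h)
    exact ⟨⟨c, show algebraMap E T c ∈ S from hc ▸ a.2⟩, Subtype.ext hc⟩⟩

end ScalarField

-- `K'` consists of the scalars in the image of `φ`, and `R` is that image.
theorem IsGaloisAction.exists_descent {G : Type*} {H : Type v} [Group G] [Group H] [Finite G]
    [Finite H] {f : H →* G} (hf : Function.Injective f) {K E T : Type u} [Field K] [Field E]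
    [Algebra K E] {B : Type*} [CommRing B] [Algebra K B] [MulSemiringAction G B] [CommRing T]
    [Nontrivial T] [Algebra E T] [MulSemiringAction H T] [SMulCommClass H E T]
    [Algebra.IsInvariant E T H] (hB : IsGaloisAction G K B) {φ : B →+* T}
    (hφ : IsTorsorHom f K E φ) :
    ∃ (K' : IntermediateField K E) (R : GaloisAlgebra H K') (α : B →+* R.carrier)
      (β : R.carrier →+* T), IsTorsorHom f K K' α ∧ IsTorsorHom (.id H) K' E β ∧
      FiniteDimensional K K' ∧
      Module.finrank K (B ⧸ RingHom.ker φ) = Module.finrank K K' * Nat.card H := by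
  let _ : Algebra K T := ((algebraMap E T).comp (algebraMap K E)).toAlgebra
  have : IsScalarTower K E T := .of_algebraMap_eq fun _ => rfl
  let φ' : B →ₐ[K] T := { φ with commutes' := hφ.map_algebraMap }
  have := hB.finite
  have : FiniteDimensional K φ'.range :=
    inferInstanceAs (FiniteDimensional K (LinearMap.range φ'.toLinearMap))
  have hstab (h : H) : ∀ x ∈ φ'.range, h • x ∈ φ'.range := by
    rintro _ ⟨y, rfl⟩
    exact ⟨f h • y, hφ.map_smul h y⟩
  let _ := stableAction φ'.range hstab
  have : SMulCommClass H (scalarField E φ'.range) φ'.range :=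
    ⟨fun h c x => by
      rw [Algebra.smul_def, smul_mul', Algebra.smul_def]
      exact congrArg (· * h • x) (Subtype.ext (smul_algebraMap h (c : E)))⟩
  have hR : IsGaloisAction H (scalarField E φ'.range) φ'.range :=
    { isInvariant_scalarField φ'.range hstab with
      exists_dual := by
        obtain ⟨n, a, b, hab⟩ := hB.exists_dual
        exact ⟨n, _, _, hab.map hf φ'.rangeRestrict.toRingHom
          fun h x => Subtype.ext (hφ.map_smul h x)⟩ }
  refine ⟨scalarField E φ'.range, hR.toGaloisAlgebra, φ'.rangeRestrict.toRingHom,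
    φ'.range.val.toRingHom, ⟨fun c => ?_, fun h x => Subtype.ext (hφ.map_smul h x)⟩,
    ⟨fun _ => rfl, fun _ _ => rfl⟩, .left K _ φ'.range, ?_⟩
  · exact (φ'.rangeRestrict.commutes c).trans
      (IsScalarTower.algebraMap_apply K (scalarField E φ'.range) φ'.range c)
  · rw [← hR.finrank_eq, Module.finrank_mul_finrank]
    exact (Ideal.quotientKerEquivRange φ').toLinearEquiv.finrank_eq

end Descent

section Monotone

variable {k : Type u} [Field k]

lemma essDimAtTorsor_le_essDimAt {G : Type v} [Group G] {F : Type u} [Field F] [Algebra k F]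
    (A : GaloisAlgebra G F) (l : ℕ) : essDimAtTorsor k l A ≤ essDimAt k G l :=
  le_sSup ⟨F, _, _, A, rfl⟩

lemma essDimAtTorsor_le_trdeg {G : Type v} [Group G] {F : Type u} [Field F] [Algebra k F]
    {A : GaloisAlgebra G F} {l : ℕ} {E : Type u} [Field E] [Algebra k E] [Algebra F E]
    [IsScalarTower k F E] [FiniteDimensional F E] (hl : ¬ l ∣ Module.finrank F E)
    {K : IntermediateField k E} {B : GaloisAlgebra G K} (h : BaseChangeIso B A E) :
    essDimAtTorsor k l A ≤ Cardinal.toENat (Algebra.trdeg k K) :=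
  sInf_le ⟨E, _, _, _, inferInstance, inferInstance, hl, K, B, h, rfl⟩

lemma trdeg_restrictScalars {K E : Type u} [Field K] [Field E] [Algebra k K] [Algebra k E]
    [Algebra K E] [IsScalarTower k K E] (K' : IntermediateField K E) [FiniteDimensional K K'] :
    Algebra.trdeg k (K'.restrictScalars k) = Algebra.trdeg k K := by
  have := trdeg_add_eq k K (A := K')
  rw [trdeg_eq_zero (R := K) (A := K'), add_zero] at this
  exact this.symm

/-- The algebra induced from a subgroup, as a torsor. -/
def GaloisAlgebra.ind {G H : Type} [Group G] [Group H] [Finite G] {f : H →* G}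
    (hf : Function.Injective f) {F : Type u} [Field F] (A : GaloisAlgebra H F) :
    GaloisAlgebra G F :=
  have : Finite H := .of_injective f hf
  have := A.nontrivial
  (A.isGaloisAction.ind hf).toGaloisAlgebra

variable {G H : Type} [Group G] [Group H] [Finite G] {f : H →* G} (hf : Function.Injective f)
include hf

lemma essDimAtTorsor_le_ind {F : Type u} [Field F] [Algebra k F] (A : GaloisAlgebra H F) (l : ℕ) :
    essDimAtTorsor k l A ≤ essDimAtTorsor k l (A.ind hf) := by
  have : Finite H := .of_injective f hf
  have := A.nontrivial
  refine le_sInf ?_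
  rintro c ⟨E, _, _, _, _, _, hl, K, B, h, rfl⟩
  obtain ⟨ψ, hψ⟩ := h.exists_isTorsorHom
  have hA := A.isGaloisAction.baseChange (E := E)
  have := hA.toIsInvariant
  have heval : IsTorsorHom f F E
      ((Algebra.TensorProduct.includeRight : A.carrier →ₐ[F] E ⊗[F] A.carrier).toRingHom.comp
        (Ind.eval f F A.carrier).toRingHom) :=
    isTorsorHom_includeRight.comp Ind.isTorsorHom_eval
  obtain ⟨K', R, α, β, -, hβ, _, -⟩ :=
    B.isGaloisAction.exists_descent hf (heval.isTorsorHom_lift.comp hψ)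
  rw [← trdeg_restrictScalars K']
  exact essDimAtTorsor_le_trdeg (K := K'.restrictScalars k) (B := R) hl
    (hA.baseChangeIso hβ isTorsorHom_includeRight)

theorem essDimAt_le_of_injective (l : ℕ) : essDimAt k H l ≤ essDimAt k G l := by
  refine sSup_le ?_
  rintro _ ⟨F, _, _, A, rfl⟩
  exact (essDimAtTorsor_le_ind hf A l).trans (essDimAtTorsor_le_essDimAt _ l)

end Monotone

section StableCore

lemma finrank_quotient_inf {F A : Type*} [Field F] [CommRing A] [Algebra F A] [Module.Finite F A]
    {I J : Ideal A} (h : I ⊔ J = ⊤) :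
    Module.finrank F (A ⧸ (I ⊓ J)) = Module.finrank F (A ⧸ I) + Module.finrank F (A ⧸ J) :=
  (AlgEquiv.ofRingEquiv (f := Ideal.quotientInfEquivQuotientProd I J
    (Ideal.isCoprime_iff_sup_eq.mpr h)) fun _ => rfl).toLinearEquiv.finrank_eq.trans
    Module.finrank_prod

variable {G H : Type*} [Group G] [Group H] {A : Type*} [CommRing A] [MulSemiringAction G A]

/-- The largest `H`-stable ideal contained in `I`, for `H` acting through `f : H →* G`. -/
def stableCore (f : H →* G) (I : Ideal A) : Ideal A :=
  ⨅ h : H, I.comap (MulSemiringAction.toRingHom G A (f h))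

variable {f : H →* G}

lemma mem_stableCore {I : Ideal A} {x : A} : x ∈ stableCore f I ↔ ∀ h : H, f h • x ∈ I := by
  simp [stableCore, Ideal.mem_comap]

lemma stableCore_sup_eq_top_or_le [Finite H] {M J : Ideal A} [hM : M.IsMaximal]
    (hJ : ∀ (h : H), ∀ x ∈ J, f h • x ∈ J) : stableCore f M ⊔ J = ⊤ ∨ J ≤ stableCore f M := by
  cases nonempty_fintype H
  refine or_iff_not_imp_left.mpr fun htop x hx => mem_stableCore.mpr fun h => ?_
  obtain ⟨N, hN, hle⟩ := Ideal.exists_le_maximal _ htop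
  have hcore : stableCore f M ≤ N := le_sup_left.trans hle
  obtain ⟨h₀, -, hh₀⟩ := (Ideal.IsPrime.inf_le' (s := Finset.univ) hN.isPrime).mp
    (by simpa [stableCore, Finset.inf_univ_eq_iInf] using hcore)
  have hmax : (M.comap (MulSemiringAction.toRingHom G A (f h₀))).IsMaximal :=
    Ideal.comap_isMaximal_of_equiv (MulSemiringAction.toRingEquiv G A (f h₀))
  have hxN : f (h₀⁻¹ * h) • x ∈ N := hle (Ideal.mem_sup_right (hJ _ _ hx))
  rw [← hmax.eq_of_le hN.ne_top hh₀, Ideal.mem_comap] at hxN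
  simpa [smul_smul] using hxN

lemma smul_mem_iInf_stableCore {s : Finset (MaximalSpectrum A)} {x : A}
    (hx : x ∈ ⨅ M ∈ s, stableCore f M.asIdeal) (h : H) :
    f h • x ∈ ⨅ M ∈ s, stableCore f M.asIdeal := by
  simp only [Ideal.mem_iInf, mem_stableCore] at hx ⊢
  intro M hM h'
  rw [smul_smul, ← map_mul]
  exact hx M hM (h' * h)

variable {F : Type*} [Field F] [Algebra F A]

lemma dvd_finrank_quotient_iInf_stableCore [Finite H] [Module.Finite F A] {n : ℕ}
    (hn : ∀ M : MaximalSpectrum A, n ∣ Module.finrank F (A ⧸ stableCore f M.asIdeal))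
    (s : Finset (MaximalSpectrum A)) :
    n ∣ Module.finrank F (A ⧸ ⨅ M ∈ s, stableCore f M.asIdeal) := by
  classical
  induction s using Finset.induction_on with
  | empty =>
    have : Subsingleton (A ⧸ ⨅ M ∈ (∅ : Finset (MaximalSpectrum A)), stableCore f M.asIdeal) := by
      simp
    rw [Module.finrank_zero_of_subsingleton]
    exact dvd_zero n
  | insert M s _ ih =>
    rw [Finset.iInf_insert]
    have := M.isMaximal
    rcases stableCore_sup_eq_top_or_le (f := f) (M := M.asIdeal)
      fun h _ hx => smul_mem_iInf_stableCore (s := s) hx h with htop | hle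
    · rw [finrank_quotient_inf htop]
      exact dvd_add (hn M) ih
    · rwa [inf_eq_right.mpr hle]

lemma IsGaloisAction.iInf_stableCore_eq_bot [Finite G] [Nontrivial A] (hA : IsGaloisAction G F A)
    (f : H →* G) : ⨅ M : MaximalSpectrum A, stableCore f M.asIdeal = ⊥ := by
  have h : ⨅ M : MaximalSpectrum A, M.asIdeal = ⊥ := by
    refine hA.eq_bot_of_stable_of_ne_top _ (fun g x hx => ?_) ?_
    · rw [Ideal.mem_iInf] at hx ⊢
      intro M
      have := M.isMaximal
      exact hx ⟨M.asIdeal.comap (MulSemiringAction.toRingEquiv G A g), inferInstance⟩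
    · obtain ⟨M, hM⟩ := Ideal.exists_maximal A
      exact ne_top_of_le_ne_top hM.ne_top (iInf_le _ (⟨M, hM⟩ : MaximalSpectrum A))
  rw [eq_bot_iff, ← h]
  exact iInf_mono fun M x hx => by simpa using mem_stableCore.mp hx 1

lemma IsGaloisAction.exists_isMaximal_not_dvd [Finite G] [Finite H] [Nontrivial A]
    (hA : IsGaloisAction G F A) (f : H →* G) {n : ℕ} (hn : ¬ n ∣ Module.finrank F A) :
    ∃ M : Ideal A, M.IsMaximal ∧ ¬ n ∣ Module.finrank F (A ⧸ stableCore f M) := by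
  have := hA.finite
  have := IsArtinianRing.of_finite F A
  cases nonempty_fintype (MaximalSpectrum A)
  by_contra! hall
  have hbot : ⨅ M ∈ (Finset.univ : Finset (MaximalSpectrum A)), stableCore f M.asIdeal = ⊥ := by
    simpa using hA.iInf_stableCore_eq_bot f
  have hdvd := dvd_finrank_quotient_iInf_stableCore (F := F) (fun M => hall _ M.isMaximal)
    (Finset.univ : Finset (MaximalSpectrum A))
  rw [hbot, (AlgEquiv.quotientBot F A).toLinearEquiv.finrank_eq] at hdvd
  exact hn hdvd

end StableCore

section Index

/-- The action of `H` on functions on `H` by right translations. -/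
@[reducible] def regularAction (H R : Type*) [Group H] [CommRing R] :
    MulSemiringAction H (H → R) where
  smul h φ y := φ (y * h)
  one_smul φ := funext fun y => congrArg φ (mul_one y)
  mul_smul g h φ := funext fun y => congrArg φ (mul_assoc y g h).symm
  smul_zero _ := rfl
  smul_add _ _ _ := rfl
  smul_one _ := rfl
  smul_mul _ _ _ := rfl

variable {G H : Type} [Group G] [Group H] [Finite G] {f : H →* G}

-- Over the residue field `E` of a maximal ideal of `A` the torsor has a point, which maps `A` to
-- the split `H`-torsor over `E`; some maximal ideal gives a descent of the right degree.
theorem GaloisAlgebra.exists_reduction (hf : Function.Injective f) {F : Type u} [Field F] {l : ℕ}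
    (hl : ¬ l * Nat.card H ∣ Nat.card G) (A : GaloisAlgebra G F) :
    ∃ (F' : Type u) (_ : Field F') (_ : Algebra F F') (_ : FiniteDimensional F F')
      (R : GaloisAlgebra H F') (α : A.carrier →+* R.carrier),
      ¬ l ∣ Module.finrank F F' ∧ IsTorsorHom f F F' α := by
  have : Finite H := .of_injective f hf
  have := A.nontrivial
  obtain ⟨M, hM, hlM⟩ := A.isGaloisAction.exists_isMaximal_not_dvd f
    (by rwa [A.isGaloisAction.finrank_eq])
  let E := A.carrier ⧸ M
  let _ : Field E := Ideal.Quotient.field M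
  let _ := regularAction H E
  have : SMulCommClass H E (H → E) := ⟨fun _ _ _ => rfl⟩
  have : Algebra.IsInvariant E (H → E) H := ⟨fun t ht =>
    ⟨t 1, funext fun h => (congrFun (ht h) 1).symm.trans (congrArg t (one_mul h))⟩⟩
  let φ : A.carrier →+* (H → E) :=
    RingHom.pi fun h => (Ideal.Quotient.mk M).comp (MulSemiringAction.toRingHom G A.carrier (f h))
  have hφ : IsTorsorHom f F E φ :=
    { map_algebraMap c := funext fun h => congrArg (Ideal.Quotient.mk M) (smul_algebraMap (f h) c)
      map_smul h x := funext fun y => by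
        change Ideal.Quotient.mk M (f y • f h • x) = Ideal.Quotient.mk M (f (y * h) • x)
        rw [map_mul, mul_smul] }
  have hker : RingHom.ker φ = stableCore f M := by
    ext x
    rw [RingHom.mem_ker, mem_stableCore, funext_iff]
    exact forall_congr' fun h => Ideal.Quotient.eq_zero_iff_mem
  obtain ⟨F', R, α, -, hα, -, hfin, hdim⟩ := A.isGaloisAction.exists_descent hf hφ
  refine ⟨F', inferInstance, inferInstance, hfin, R, α, fun hdvd => hlM ?_, hα⟩
  rw [← hker, hdim]
  exact mul_dvd_mul_right hdvd _

variable {k : Type u} [Field k] (hf : Function.Injective f) {l : ℕ} (hlp : l.Prime)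
include hf hlp

lemma essDimAtTorsor_le_of_reduction {F F' : Type u} [Field F] [Field F'] [Algebra k F]
    [Algebra k F'] [Algebra F F'] [IsScalarTower k F F'] [FiniteDimensional F F']
    (hdeg : ¬ l ∣ Module.finrank F F') {A : GaloisAlgebra G F} {R : GaloisAlgebra H F'}
    {α : A.carrier →+* R.carrier} (hα : IsTorsorHom f F F' α) :
    essDimAtTorsor k l A ≤ essDimAtTorsor k l R := by
  have : Finite H := .of_injective f hf
  have := R.nontrivial
  refine le_sInf ?_
  rintro c ⟨E, _, _, _, _, _, hlE, K, B, h, rfl⟩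
  let _ : Algebra F E := ((algebraMap F' E).comp (algebraMap F F')).toAlgebra
  have : IsScalarTower F F' E := .of_algebraMap_eq fun _ => rfl
  have : IsScalarTower k F E := .of_algebraMap_eq fun c => by
    rw [IsScalarTower.algebraMap_apply k F' E, IsScalarTower.algebraMap_apply k F F']
    rfl
  have hdim : ¬ l ∣ Module.finrank F E := by
    rw [← Module.finrank_mul_finrank F F' E, hlp.dvd_mul]
    exact not_or.mpr ⟨hdeg, hlE⟩
  obtain ⟨ψ, hψ⟩ := h.exists_isTorsorHom
  have hA := Ind.isTorsorHom_lift (isTorsorHom_includeRight (E := E).comp hα)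
  have hB := Ind.isTorsorHom_lift (hψ.comp (Ind.isTorsorHom_eval (f := f)))
  have : FiniteDimensional F E := .trans F F' E
  exact essDimAtTorsor_le_trdeg (B := B.ind hf) hdim
    ((R.isGaloisAction.baseChange.ind hf).baseChangeIso hB hA)

theorem essDimAt_le_of_index (hl : ¬ l * Nat.card H ∣ Nat.card G) :
    essDimAt k G l ≤ essDimAt k H l := by
  have : Finite H := .of_injective f hf
  refine sSup_le ?_
  rintro _ ⟨F, _, _, A, rfl⟩
  obtain ⟨F', _, _, _, R, α, hdeg, hα⟩ := A.exists_reduction hf hl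
  let _ : Algebra k F' := ((algebraMap F F').comp (algebraMap k F)).toAlgebra
  have : IsScalarTower k F F' := .of_algebraMap_eq fun _ => rfl
  exact (essDimAtTorsor_le_of_reduction hf hlp hdeg hα).trans (essDimAtTorsor_le_essDimAt R l)

end Index

section Sylow

universe w

variable {G : Type v} {G' : Type w} [Group G] [Group G']

lemma IsGaloisAction.compHom {F A : Type*} [CommRing F] [CommRing A] [Algebra F A]
    [MulSemiringAction G A] (hA : IsGaloisAction G F A) (e : G' ≃* G) :
    letI := MulSemiringAction.compHom A e.toMonoidHom
    IsGaloisAction G' F A :=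
  letI := MulSemiringAction.compHom A e.toMonoidHom
  { isInvariant := fun a ha => hA.isInvariant a (e.surjective.forall.mpr ha)
    exists_dual := by
      obtain ⟨n, a, b, hab⟩ := hA.exists_dual
      exact ⟨n, a, b, hab.map (f := e.toMonoidHom) e.injective (.id A) fun _ _ => rfl⟩ }

/-- Transport of a torsor along an isomorphism of groups. -/
def GaloisAlgebra.transport [Finite G'] {F : Type u} [Field F] (A : GaloisAlgebra G F)
    (e : G' ≃* G) : GaloisAlgebra G' F :=
  letI := MulSemiringAction.compHom A.carrier e.toMonoidHom
  haveI : SMulCommClass G' F A.carrier := ⟨fun g c x => smul_comm (e g) c x⟩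
  haveI := A.nontrivial
  haveI : Finite G := .of_equiv G' e.toEquiv
  (A.isGaloisAction.compHom e).toGaloisAlgebra

lemma not_mul_card_sylow_dvd [Finite G'] {l n : ℕ} [hl : Fact l.Prime] (P : Sylow l G') (hn : n ≠ 0)
    (h : (Nat.card G').factorization l = n.factorization l) : ¬ l * Nat.card P ∣ n := by
  rw [P.card_eq_multiplicity, h, ← pow_succ']
  exact Nat.pow_succ_factorization_not_dvd hn hl.out

lemma injective_comp_subtype_sylow {l : ℕ} [Fact l.Prime] (f : G' →* G)
    (hker : ¬ l ∣ Nat.card f.ker) (P : Sylow l G') :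
    Function.Injective (f.comp (P : Subgroup G').subtype) := by
  refine (injective_iff_map_eq_one _).mpr fun x hx => ?_
  have hxker : (x : G') ∈ f.ker := hx
  by_contra hne
  refine hker ((P.isPGroup'.dvd_orderOf hne).trans ?_)
  rw [← Subgroup.orderOf_coe, ← Subgroup.orderOf_mk _ hxker]
  exact orderOf_dvd_natCard _

variable {k : Type u} [Field k] [Finite G]

lemma essDimAt_le_of_mulEquiv (e : G ≃* G') (l : ℕ) : essDimAt k G l ≤ essDimAt k G' l := by
  have : Finite G' := .of_equiv G e.toEquiv
  refine sSup_le ?_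
  rintro _ ⟨F, _, _, A, rfl⟩
  refine le_trans (le_sInf ?_) (essDimAtTorsor_le_essDimAt (A.transport e.symm) l)
  rintro c ⟨E, _, _, _, _, _, hl, K, B, ⟨φ, hφ⟩, rfl⟩
  refine essDimAtTorsor_le_trdeg (B := B.transport e) hl ⟨φ, fun g x => ?_⟩
  refine (hφ (e g) x).trans ?_
  change baseChangeAct A E (e.symm (e g)) (φ x) = _
  rw [e.symm_apply_apply]
  rfl

lemma essDimAt_congr (e : G ≃* G') (l : ℕ) : essDimAt k G l = essDimAt k G' l :=
  have : Finite G' := .of_equiv G e.toEquiv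
  (essDimAt_le_of_mulEquiv e l).antisymm (essDimAt_le_of_mulEquiv e.symm l)

theorem essDimAt_eq_of_injective {f : G' →* G} (hf : Function.Injective f) {l : ℕ} (hl : l.Prime)
    (h : ¬ l * Nat.card G' ∣ Nat.card G) : essDimAt k G' l = essDimAt k G l := by
  have : Finite G' := .of_injective f hf
  obtain ⟨H₀, _, _, ⟨eH⟩⟩ := Finite.exists_type_univ_nonempty_mulEquiv.{w, 0} G'
  obtain ⟨G₀, _, _, ⟨eG⟩⟩ := Finite.exists_type_univ_nonempty_mulEquiv.{v, 0} G
  rw [essDimAt_congr eH, essDimAt_congr eG]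
  let f₀ : H₀ →* G₀ := eG.toMonoidHom.comp (f.comp eH.symm.toMonoidHom)
  have hf₀ : Function.Injective f₀ := eG.injective.comp (hf.comp eH.symm.injective)
  rw [Nat.card_congr eH.toEquiv, Nat.card_congr eG.toEquiv] at h
  exact (essDimAt_le_of_injective hf₀ l).antisymm (essDimAt_le_of_index hf₀ hl h)

-- A Sylow `l`-subgroup of `G'` embeds as a Sylow `l`-subgroup in both groups.
theorem essDimAt_eq_of_hom [Finite G'] (f : G' →* G) {l : ℕ} (hl : l.Prime)
    (hker : ¬ l ∣ Nat.card f.ker)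
    (h : (Nat.card G').factorization l = (Nat.card G).factorization l) :
    essDimAt k G' l = essDimAt k G l := by
  have : Fact l.Prime := ⟨hl⟩
  let P : Sylow l G' := default
  rw [← essDimAt_eq_of_injective (Subgroup.subtype_injective (P : Subgroup G')) hl
      (not_mul_card_sylow_dvd P Nat.card_pos.ne' rfl),
    ← essDimAt_eq_of_injective (injective_comp_subtype_sylow f hker P) hl
      (not_mul_card_sylow_dvd P Nat.card_pos.ne' h)]

theorem essDimAt_eq_of_injective_of_factorization_eq {f : G' →* G}
    (hf : Function.Injective f) {l : ℕ} (hl : l.Prime)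
    (h : (Nat.card G').factorization l = (Nat.card G).factorization l) :
    essDimAt k G' l = essDimAt k G l := by
  have : Finite G' := .of_injective f hf
  refine essDimAt_eq_of_hom f hl ?_ h
  rw [(MonoidHom.ker_eq_bot_iff f).mpr hf, Subgroup.card_bot]
  exact hl.not_dvd_one

end Sylow

end EssDim

namespace FiniteOrthogonal

section Isometries

open QuadraticMap

variable {F : Type*} [Field F] {V : Type*} [AddCommGroup V] [Module F V]

instance [Finite V] : Finite (V ≃ₗ[F] V) :=
  Finite.of_injective (fun g => (g : V → V)) DFunLike.coe_injective

/-- The group of linear isometries of a quadratic form. -/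
def isom (Q : QuadraticForm F V) : Subgroup (V ≃ₗ[F] V) where
  carrier := {g | ∀ x, Q (g x) = Q x}
  one_mem' := fun _ => rfl
  mul_mem' := fun {g h} hg hh x => by rw [LinearEquiv.mul_apply, hg, hh]
  inv_mem' := fun {g} hg x => by
    rw [← hg, ← LinearEquiv.mul_apply, mul_inv_cancel, LinearEquiv.coe_one, id]

variable {Q : QuadraticForm F V}

lemma mem_isom {g : V ≃ₗ[F] V} : g ∈ isom Q ↔ ∀ x, Q (g x) = Q x := Iff.rfl

lemma polar_of_mem_isom {g : V ≃ₗ[F] V} (hg : g ∈ isom Q) (x y : V) :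
    polar Q (g x) (g y) = polar Q x y := by
  simp only [polar, ← map_add, mem_isom.mp hg]

lemma map_add_smul (x y : V) (t : F) : Q (x + t • y) = Q x + t * polar Q x y + t * t * Q y := by
  rw [QuadraticMap.map_add Q, QuadraticMap.map_smul, polar_smul_right, smul_eq_mul, smul_eq_mul]
  ring

lemma map_sub_eq (x y : V) : Q (x - y) = Q x - polar Q x y + Q y := by
  rw [sub_eq_add_neg, QuadraticMap.map_add Q, QuadraticMap.map_neg, polar_neg_right]
  ring

/-- The reflection `y ↦ y - (polar Q v y / Q v) • v` in a nonsingular vector `v`; in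
characteristic two this is the orthogonal transvection. -/
def reflEquiv (Q : QuadraticForm F V) (v : V) (hv : Q v ≠ 0) : V ≃ₗ[F] V :=
  Module.reflection (x := v) (f := (Q v)⁻¹ • Q.polarBilin v) (by
    rw [LinearMap.smul_apply, polarBilin_apply_apply, polar_self, smul_eq_mul, nsmul_eq_mul,
      mul_left_comm, inv_mul_cancel₀ hv, mul_one, Nat.cast_ofNat])

lemma reflEquiv_apply {v : V} (hv : Q v ≠ 0) (y : V) :
    reflEquiv Q v hv y = y - ((Q v)⁻¹ * polar Q v y) • v := by
  simp [reflEquiv, Module.reflection_apply]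

lemma reflEquiv_mul_self {v : V} (hv : Q v ≠ 0) : reflEquiv Q v hv * reflEquiv Q v hv = 1 :=
  LinearEquiv.ext fun y => Module.involutive_reflection _ y

lemma reflEquiv_apply_apply {v : V} (hv : Q v ≠ 0) (y : V) :
    reflEquiv Q v hv (reflEquiv Q v hv y) = y :=
  Module.involutive_reflection _ y

lemma reflEquiv_mem_isom {v : V} (hv : Q v ≠ 0) : reflEquiv Q v hv ∈ isom Q := fun y => by
  rw [reflEquiv_apply, sub_eq_add_neg, ← neg_smul, map_add_smul, polar_comm Q y v]
  field_simp
  ring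

lemma reflEquiv_sub_apply {x y : V} (h : Q x = Q y) (hv : Q (y - x) ≠ 0) :
    reflEquiv Q (y - x) hv x = y := by
  have hpolar : polar Q (y - x) x = -Q (y - x) := by
    rw [polar_sub_left, polar_self, map_sub_eq, h]
    ring
  rw [reflEquiv_apply, hpolar, mul_neg, inv_mul_cancel₀ hv, neg_smul, one_smul]
  abel

/-- The set of reflections of a quadratic space. -/
def reflections (Q : QuadraticForm F V) : Set (V ≃ₗ[F] V) :=
  {g | ∃ (v : V) (hv : Q v ≠ 0), g = reflEquiv Q v hv}

lemma closure_reflections_le : Subgroup.closure (reflections Q) ≤ isom Q := by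
  rw [Subgroup.closure_le]
  rintro _ ⟨v, hv, rfl⟩
  exact reflEquiv_mem_isom hv

lemma ncard_ne_reflEquiv_mul_lt [Finite V] {g : V ≃ₗ[F] V} (hg : g ∈ isom Q) {x : V}
    (hx : Q (g x - x) ≠ 0) :
    {y | (reflEquiv Q (g x - x) hx * g) y ≠ y}.ncard < {y | g y ≠ y}.ncard := by
  have hgx : reflEquiv Q (g x - x) hx (g x) = x :=
    (congrArg _ (reflEquiv_sub_apply (hg x).symm hx)).symm.trans (reflEquiv_apply_apply hx x)
  refine Set.ncard_lt_ncard ((Set.ssubset_iff_of_subset fun y hy => ?_).mpr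
    ⟨x, fun h => hx (by rw [h, sub_self, QuadraticMap.map_zero]), fun h => h hgx⟩)
    (Set.toFinite _)
  rw [Set.mem_ofPred_eq] at hy ⊢
  intro hgy
  apply hy
  have hpolar : polar Q (g x) y = polar Q x y := by
    conv_lhs => rw [← hgy]
    exact polar_of_mem_isom hg x y
  rw [LinearEquiv.mul_apply, hgy, reflEquiv_apply, polar_sub_left, hpolar, sub_self, mul_zero,
    zero_smul, sub_zero]

theorem isom_le_closure_of_anisotropic [Finite V] (hQ : Q.Anisotropic) :
    isom Q ≤ Subgroup.closure (reflections Q) := by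
  intro g
  induction hn : {y | g y ≠ y}.ncard using Nat.strong_induction_on generalizing g with
  | _ n ih =>
    intro hg
    by_cases h1 : ∀ x, g x = x
    · rw [show g = 1 from LinearEquiv.ext h1]
      exact one_mem _
    · obtain ⟨x, hx⟩ := not_forall.mp h1
      have hu : Q (g x - x) ≠ 0 := fun h => hx (sub_eq_zero.mp (hQ _ h))
      have hr : reflEquiv Q (g x - x) hu ∈ Subgroup.closure (reflections Q) :=
        Subgroup.subset_closure ⟨_, hu, rfl⟩
      rw [← Subgroup.mul_mem_cancel_left _ hr]
      exact ih _ (hn ▸ ncard_ne_reflEquiv_mul_lt hg hu) rfl (mul_mem (reflEquiv_mem_isom hu) hg)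

/-- A quadratic form is regular if the radical of its polar form contains no nonzero singular
vector. In characteristic two this allows the one-dimensional radical of the odd-dimensional
forms. -/
def Regular (Q : QuadraticForm F V) : Prop :=
  ∀ x, (∀ y, polar Q x y = 0) → Q x = 0 → x = 0

lemma exists_reflections_apply_eq_of_polar_ne_zero {x y : V} (hx : Q x = 0) (hy : Q y = 0)
    (hxy : polar Q x y ≠ 0) : ∃ g ∈ Subgroup.closure (reflections Q), g x = y := by
  have hne : Q (y - x) ≠ 0 := by
    rwa [map_sub_eq, hx, hy, polar_comm, zero_sub, add_zero, neg_ne_zero]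
  exact ⟨_, Subgroup.subset_closure ⟨_, hne, rfl⟩, reflEquiv_sub_apply (hx.trans hy.symm) hne⟩

lemma Regular.exists_polar_ne_zero (hQ : Regular Q) {x : V} (hx : x ≠ 0) (hQx : Q x = 0) :
    ∃ u, polar Q x u ≠ 0 := by
  by_contra! h
  exact hx (hQ x h hQx)

lemma Regular.exists_polar_ne_zero_and (hQ : Regular Q) {x y : V} (hx : x ≠ 0) (hy : y ≠ 0)
    (hQx : Q x = 0) (hQy : Q y = 0) : ∃ u, polar Q x u ≠ 0 ∧ polar Q y u ≠ 0 := by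
  obtain ⟨u, hu⟩ := hQ.exists_polar_ne_zero hx hQx
  obtain ⟨w, hw⟩ := hQ.exists_polar_ne_zero hy hQy
  by_cases hyu : polar Q y u = 0
  · by_cases hxw : polar Q x w = 0
    · exact ⟨u + w, by rwa [polar_add_right, hxw, add_zero],
        by rwa [polar_add_right, hyu, zero_add]⟩
    · exact ⟨w, hxw, hw⟩
  · exact ⟨u, hu, hyu⟩

theorem exists_reflections_apply_eq (hQ : Regular Q) {x y : V} (hx : x ≠ 0) (hy : y ≠ 0)
    (hQx : Q x = 0) (hQy : Q y = 0) : ∃ g ∈ Subgroup.closure (reflections Q), g x = y := by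
  by_cases hxy : polar Q x y = 0
  · -- Both `x` and `y` can be moved to a singular vector orthogonal to neither of them.
    obtain ⟨u, hxu, hyu⟩ := hQ.exists_polar_ne_zero_and hx hy hQx hQy
    let z := u + (-(Q u / polar Q x u)) • x
    have hz : Q z = 0 := by
      rw [map_add_smul, hQx, polar_comm Q u x]
      field_simp
      ring
    have hxz : polar Q x z ≠ 0 := by
      rwa [polar_add_right, polar_smul_right, polar_self, hQx, smul_zero, smul_zero, add_zero]
    have hyz : polar Q z y ≠ 0 := by
      rwa [polar_comm, polar_add_right, polar_smul_right, polar_comm Q y x, hxy, smul_zero,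
        add_zero]
    obtain ⟨g, hg, hgx⟩ := exists_reflections_apply_eq_of_polar_ne_zero hQx hz hxz
    obtain ⟨h, hh, hhz⟩ := exists_reflections_apply_eq_of_polar_ne_zero hz hQy hyz
    exact ⟨h * g, mul_mem hh hg, by rw [LinearEquiv.mul_apply, hgx, hhz]⟩
  · exact exists_reflections_apply_eq_of_polar_ne_zero hQx hQy hxy

/-- The isometry group is generated by reflections and elements of order dividing `p`. -/
def GeneratedBy (p : ℕ) (Q : QuadraticForm F V) : Prop :=
  isom Q ≤ Subgroup.closure (reflections Q ∪ {g | g ∈ isom Q ∧ g ^ p = 1})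

lemma ncard_ne_zero_zeros (Q : QuadraticForm F V) :
    {x | x ≠ 0 ∧ Q x = 0}.ncard = Nat.card {x // Q x = 0} - 1 := by
  have h : {x | x ≠ 0 ∧ Q x = 0} = {x | Q x = 0} \ {0} := by
    ext x
    simp [and_comm]
  rw [h, Set.ncard_sdiff_singleton_of_mem (by exact QuadraticMap.map_zero Q)]
  rfl

end Isometries

section Transport

open QuadraticMap

variable {F : Type*} [Field F] {V W : Type*} [AddCommGroup V] [Module F V] [AddCommGroup W]
  [Module F W] {Q : QuadraticForm F V} {R : QuadraticForm F W}

/-- Conjugation of linear automorphisms by a linear equivalence. -/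
def autCongr (e : V ≃ₗ[F] W) : (V ≃ₗ[F] V) ≃* (W ≃ₗ[F] W) where
  toFun g := e.symm.trans (g.trans e)
  invFun g := e.trans (g.trans e.symm)
  left_inv g := LinearEquiv.ext fun x => by simp
  right_inv g := LinearEquiv.ext fun x => by simp
  map_mul' g h := LinearEquiv.ext fun x => by simp [LinearEquiv.mul_apply]

lemma autCongr_apply (e : V ≃ₗ[F] W) (g : V ≃ₗ[F] V) (x : W) :
    autCongr e g x = e (g (e.symm x)) := rfl

lemma map_autCongr_isom (e : Q.IsometryEquiv R) :
    (isom Q).map (autCongr e.toLinearEquiv).toMonoidHom = isom R := by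
  ext g
  rw [Subgroup.mem_map_equiv, mem_isom, mem_isom]
  change (∀ x, Q (e.symm (g (e x))) = Q x) ↔ _
  simp only [e.symm.map_app]
  refine ⟨fun h x => ?_, fun h x => by rw [h, e.map_app]⟩
  rw [← e.apply_symm_apply x, h, e.map_app]

/-- The isomorphism of the isometry groups of two isometric quadratic spaces. -/
def isomCongr (e : Q.IsometryEquiv R) : isom Q ≃* isom R :=
  ((autCongr e.toLinearEquiv).subgroupMap (isom Q)).trans
    (MulEquiv.subgroupCongr (map_autCongr_isom e))

lemma polar_isometryEquiv (e : Q.IsometryEquiv R) (x y : V) :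
    polar R (e x) (e y) = polar Q x y := by
  simp only [polar, ← map_add, e.map_app]

lemma Regular.of_isometryEquiv (h : Regular Q) (e : Q.IsometryEquiv R) : Regular R := by
  intro x hx h0
  refine (EmbeddingLike.map_eq_zero_iff (f := e.symm)).mp (h _ (fun y => ?_) ?_)
  · rw [← e.symm_apply_apply y, polar_isometryEquiv, hx]
  · rw [e.symm.map_app, h0]

lemma card_zeros_congr (e : Q.IsometryEquiv R) :
    Nat.card {x // Q x = 0} = Nat.card {x // R x = 0} :=
  Nat.card_congr (e.toLinearEquiv.toEquiv.subtypeEquiv fun x => by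
    rw [LinearEquiv.coe_toEquiv, e.coe_toLinearEquiv, e.map_app])

lemma autCongr_reflEquiv (e : Q.IsometryEquiv R) {v : V} (hv : Q v ≠ 0) (hv' : R (e v) ≠ 0) :
    autCongr e.toLinearEquiv (reflEquiv Q v hv) = reflEquiv R (e v) hv' := by
  refine LinearEquiv.ext fun x => ?_
  obtain ⟨x, rfl⟩ := e.toLinearEquiv.surjective x
  rw [autCongr_apply, LinearEquiv.symm_apply_apply, reflEquiv_apply, reflEquiv_apply,
    e.coe_toLinearEquiv, polar_isometryEquiv, e.map_app, map_sub, map_smul]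

lemma GeneratedBy.of_isometryEquiv {p : ℕ} (h : GeneratedBy p Q) (e : Q.IsometryEquiv R) :
    GeneratedBy p R := by
  rw [GeneratedBy, ← map_autCongr_isom e, Subgroup.map_le_iff_le_comap]
  refine h.trans ((Subgroup.closure_le _).mpr ?_)
  rintro k (⟨u, hu, rfl⟩ | ⟨hk, hp⟩)
  · have hu' : R (e u) ≠ 0 := by rwa [e.map_app]
    exact Subgroup.subset_closure (Or.inl ⟨e u, hu', autCongr_reflEquiv e hu hu'⟩)
  · refine Subgroup.subset_closure (Or.inr ⟨Subgroup.mem_map_of_mem _ hk, ?_⟩)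
    rw [← map_pow, hp, map_one]

end Transport

section Hyperbolic

open QuadraticMap

variable {F : Type*} [Field F] {V : Type*} [AddCommGroup V] [Module F V]

/-- The orthogonal sum of a hyperbolic plane and `Q`. -/
def hyp (Q : QuadraticForm F V) : QuadraticForm F ((F × F) × V) :=
  (linMulLin (LinearMap.fst F F F) (LinearMap.snd F F F)).prod Q

variable {Q : QuadraticForm F V}

lemma hyp_apply (x : (F × F) × V) : hyp Q x = x.1.1 * x.1.2 + Q x.2 := by
  simp [hyp]

lemma polar_hyp (x y : (F × F) × V) :
    polar (hyp Q) x y = x.1.1 * y.1.2 + y.1.1 * x.1.2 + polar Q x.2 y.2 := by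
  simp only [polar, hyp_apply, Prod.fst_add, Prod.snd_add]
  ring

lemma Regular.hyp (hQ : Regular Q) : Regular (hyp Q) := by
  rintro ⟨⟨a, b⟩, v⟩ hx h0
  have ha : a = 0 := by simpa [polar_hyp] using hx ((0, 1), 0)
  have hb : b = 0 := by simpa [polar_hyp] using hx ((1, 0), 0)
  subst ha hb
  have hv : v = 0 := hQ v (fun y => by simpa [polar_hyp] using hx ((0, 0), y))
    (by simpa [hyp_apply] using h0)
  rw [hv, Prod.mk_zero_zero, Prod.mk_zero_zero]

/-- The underlying linear map of an Eichler transformation of the hyperbolic extension of `Q`. -/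
def eichlerMap (Q : QuadraticForm F V) (v : V) : ((F × F) × V) →ₗ[F] ((F × F) × V) where
  toFun x := ((x.1.1 - polar Q v x.2 - Q v * x.1.2, x.1.2), x.2 + x.1.2 • v)
  map_add' x y := by
    simp only [Prod.fst_add, Prod.snd_add, polar_add_right, add_smul, Prod.mk_add_mk,
      Prod.mk.injEq, and_true]
    exact ⟨by ring, by abel⟩
  map_smul' c x := by
    simp only [Prod.smul_fst, Prod.smul_snd, polar_smul_right, RingHom.id_apply, smul_eq_mul,
      Prod.smul_mk, smul_add, mul_smul, Prod.mk.injEq, and_true]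
    ring

lemma eichlerMap_apply (Q : QuadraticForm F V) (v : V) (x : (F × F) × V) :
    eichlerMap Q v x = ((x.1.1 - polar Q v x.2 - Q v * x.1.2, x.1.2), x.2 + x.1.2 • v) := rfl

lemma eichlerMap_zero (Q : QuadraticForm F V) : eichlerMap Q 0 = LinearMap.id := by
  refine LinearMap.ext fun x => ?_
  simp [eichlerMap_apply]

lemma eichlerMap_add (Q : QuadraticForm F V) (v w : V) :
    eichlerMap Q (v + w) = eichlerMap Q v ∘ₗ eichlerMap Q w := by
  refine LinearMap.ext fun x => ?_
  simp only [LinearMap.comp_apply, eichlerMap_apply, polar_add_left, polar_add_right,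
    polar_smul_right, QuadraticMap.map_add Q v w, smul_eq_mul, smul_add, Prod.mk.injEq, and_true]
  exact ⟨by ring, by abel⟩

/-- The Eichler transformations of the hyperbolic extension of `Q`, as a homomorphism from `V`.
They fix the first vector of the hyperbolic pair. -/
def eichler (Q : QuadraticForm F V) : Multiplicative V →* (((F × F) × V) ≃ₗ[F] ((F × F) × V)) where
  toFun v := LinearEquiv.ofLinearMap (eichlerMap Q v.toAdd) (eichlerMap Q (-v.toAdd))
    (by rw [← eichlerMap_add, add_neg_cancel, eichlerMap_zero])
    (by rw [← eichlerMap_add, neg_add_cancel, eichlerMap_zero])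
  map_one' := LinearEquiv.ext fun x => congrArg (· x) (eichlerMap_zero Q)
  map_mul' v w := LinearEquiv.ext fun x => congrArg (· x) (eichlerMap_add Q v.toAdd w.toAdd)

lemma eichler_apply (v : V) (x : (F × F) × V) : eichler Q (.ofAdd v) x =
    ((x.1.1 - polar Q v x.2 - Q v * x.1.2, x.1.2), x.2 + x.1.2 • v) := rfl

lemma eichler_mem_isom (v : Multiplicative V) : eichler Q v ∈ isom (hyp Q) := by
  obtain ⟨v, rfl⟩ := Multiplicative.ofAdd.surjective v
  intro x
  simp only [eichler_apply, hyp_apply, map_add_smul, polar_comm Q v]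
  ring

lemma eichler_pow_char (p : ℕ) [CharP F p] (v : Multiplicative V) : eichler Q v ^ p = 1 := by
  obtain ⟨v, rfl⟩ := Multiplicative.ofAdd.surjective v
  rw [← map_pow, ← ofAdd_nsmul, ← Nat.cast_smul_eq_nsmul F, CharP.cast_eq_zero, zero_smul,
    ofAdd_zero, map_one]

/-- Extension of a linear automorphism by the identity of the hyperbolic plane. -/
def extHyp : (V ≃ₗ[F] V) →* (((F × F) × V) ≃ₗ[F] ((F × F) × V)) where
  toFun g := (LinearEquiv.refl F (F × F)).prodCongr g
  map_one' := rfl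
  map_mul' _ _ := rfl

lemma extHyp_apply (g : V ≃ₗ[F] V) (x : (F × F) × V) : extHyp g x = (x.1, g x.2) := rfl

lemma extHyp_injective : Function.Injective (extHyp (F := F) (V := V)) := fun _ _ hgh =>
  LinearEquiv.ext fun x => congrArg Prod.snd (LinearEquiv.congr_fun hgh ((0, 0), x))

lemma extHyp_mem_isom {g : V ≃ₗ[F] V} (hg : g ∈ isom Q) : extHyp g ∈ isom (hyp Q) := fun x => by
  rw [extHyp_apply, hyp_apply, hyp_apply, mem_isom.mp hg]

lemma fst_apply_of_fixes_hyperbolic_pair {g : ((F × F) × V) ≃ₗ[F] ((F × F) × V)}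
    (hg : g ∈ isom (hyp Q)) (he : g ((1, 0), 0) = ((1, 0), 0)) (hf : g ((0, 1), 0) = ((0, 1), 0))
    (v : V) : (g ((0, 0), v)).1 = (0, 0) := by
  have h₁ := polar_of_mem_isom hg ((1, 0), 0) ((0, 0), v)
  have h₂ := polar_of_mem_isom hg ((0, 1), 0) ((0, 0), v)
  rw [he] at h₁
  rw [hf] at h₂
  simp only [polar_hyp, polar_zero_left] at h₁ h₂
  exact Prod.ext (by simpa using h₂) (by simpa using h₁)

lemma exists_extHyp_eq {g : ((F × F) × V) ≃ₗ[F] ((F × F) × V)} (hg : g ∈ isom (hyp Q))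
    (he : g ((1, 0), 0) = ((1, 0), 0)) (hf : g ((0, 1), 0) = ((0, 1), 0)) :
    ∃ h ∈ isom Q, extHyp h = g := by
  have hgv : ∀ v, g ((0, 0), v) = ((0, 0), (g ((0, 0), v)).2) := fun v =>
    Prod.ext (fst_apply_of_fixes_hyperbolic_pair hg he hf v) rfl
  have hgv' : ∀ v, g.symm ((0, 0), v) = ((0, 0), (g.symm ((0, 0), v)).2) := fun v =>
    Prod.ext (fst_apply_of_fixes_hyperbolic_pair (inv_mem hg) (g.symm_apply_eq.mpr he.symm)
      (g.symm_apply_eq.mpr hf.symm) v) rfl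
  let ι : V →ₗ[F] (F × F) × V := LinearMap.inr F (F × F) V
  let π : (F × F) × V →ₗ[F] V := LinearMap.snd F (F × F) V
  let h : V ≃ₗ[F] V := LinearEquiv.ofLinearMap (π ∘ₗ g.toLinearMap ∘ₗ ι)
    (π ∘ₗ g.symm.toLinearMap ∘ₗ ι)
    (LinearMap.ext fun v => by
      change (g ((0, 0), (g.symm ((0, 0), v)).2)).2 = v
      rw [← hgv', g.apply_symm_apply])
    (LinearMap.ext fun v => by
      change (g.symm ((0, 0), (g ((0, 0), v)).2)).2 = v
      rw [← hgv, g.symm_apply_apply])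
  have hgh : ∀ v, g ((0, 0), v) = ((0, 0), h v) := hgv
  refine ⟨h, fun v => ?_, LinearEquiv.ext fun ⟨⟨a, b⟩, v⟩ => ?_⟩
  · simpa [hgh, hyp_apply] using hg ((0, 0), v)
  · have hx : (((a, b), v) : (F × F) × V) =
        a • ((1, 0), 0) + b • ((0, 1), 0) + ((0, 0), v) := by simp
    rw [extHyp_apply, hx, map_add, map_add, map_smul, map_smul, he, hf, hgh]
    simp

lemma exists_eichler_mul_extHyp {g : ((F × F) × V) ≃ₗ[F] ((F × F) × V)} (hg : g ∈ isom (hyp Q))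
    (he : g ((1, 0), 0) = ((1, 0), 0)) :
    ∃ v, ∃ h ∈ isom Q, g = eichler Q v * extHyp h := by
  let v := (g ((0, 1), 0)).2
  have hsnd : (g ((0, 1), 0)).1.2 = 1 := by
    have := polar_of_mem_isom hg ((1, 0), 0) ((0, 1), 0)
    rw [he] at this
    simpa [polar_hyp] using this
  have hfst : (g ((0, 1), 0)).1.1 = -Q v := by
    have := mem_isom.mp hg ((0, 1), 0)
    rw [hyp_apply, hyp_apply, hsnd, mul_one, zero_mul, QuadraticMap.map_zero, add_zero] at this
    exact eq_neg_of_add_eq_zero_left this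
  have hf : g ((0, 1), 0) = ((-Q v, 1), v) := Prod.ext (Prod.ext hfst hsnd) rfl
  obtain ⟨h, hh, hgh⟩ := exists_extHyp_eq (mul_mem (inv_mem (eichler_mem_isom (.ofAdd v))) hg)
    ((LinearEquiv.symm_apply_eq _).mpr (by simp [he, eichler_apply]))
    ((LinearEquiv.symm_apply_eq _).mpr (by simp [hf, eichler_apply]))
  exact ⟨.ofAdd v, h, hh, by rw [hgh, mul_inv_cancel_left]⟩

lemma exists_mul_eichler_mul_extHyp (hQ : Regular Q)
    {g : ((F × F) × V) ≃ₗ[F] ((F × F) × V)} (hg : g ∈ isom (hyp Q)) :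
    ∃ r ∈ Subgroup.closure (reflections (hyp Q)), ∃ v, ∃ h ∈ isom Q,
      g = r * eichler Q v * extHyp h := by
  obtain ⟨r, hr, hre⟩ := exists_reflections_apply_eq hQ.hyp (x := ((1, 0), 0))
    (y := g ((1, 0), 0)) (by simp) (by simp) (by simp [hyp_apply])
    (by rw [mem_isom.mp hg]; simp [hyp_apply])
  obtain ⟨v, h, hh, hgh⟩ := exists_eichler_mul_extHyp
    (mul_mem (inv_mem (closure_reflections_le hr)) hg) (r.symm_apply_eq.mpr hre.symm)
  exact ⟨r, hr, v, h, hh, by rw [mul_assoc, ← hgh, mul_inv_cancel_left]⟩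

lemma extHyp_reflEquiv {u : V} (hu : Q u ≠ 0) (hu' : hyp Q ((0, 0), u) ≠ 0) :
    extHyp (reflEquiv Q u hu) = reflEquiv (hyp Q) ((0, 0), u) hu' := by
  refine LinearEquiv.ext fun x => ?_
  rw [extHyp_apply, reflEquiv_apply, reflEquiv_apply]
  simp [hyp_apply, polar_hyp, Prod.ext_iff]

theorem GeneratedBy.hyp {p : ℕ} [CharP F p] (hQ : Regular Q) (h : GeneratedBy p Q) :
    GeneratedBy p (hyp Q) := by
  intro g hg
  obtain ⟨r, hr, v, k, hk, rfl⟩ := exists_mul_eichler_mul_extHyp hQ hg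
  refine mul_mem (mul_mem (Subgroup.closure_mono Set.subset_union_left hr)
    (Subgroup.subset_closure (Or.inr ⟨eichler_mem_isom v, eichler_pow_char p v⟩))) ?_
  rw [← Subgroup.mem_comap]
  refine (Subgroup.closure_le _).mpr ?_ (h hk)
  rintro _ (⟨u, hu, rfl⟩ | ⟨hg, hp⟩)
  · have hu' : FiniteOrthogonal.hyp Q ((0, 0), u) ≠ 0 := by simpa [hyp_apply] using hu
    exact Subgroup.subset_closure (Or.inl ⟨((0, 0), u), hu', extHyp_reflEquiv hu hu'⟩)
  · exact Subgroup.subset_closure (Or.inr ⟨extHyp_mem_isom hg, by rw [← map_pow, hp, map_one]⟩)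

lemma orbit_isom_hyp (hQ : Regular Q) :
    MulAction.orbit (isom (hyp Q)) (((1, 0), 0) : (F × F) × V) = {x | x ≠ 0 ∧ hyp Q x = 0} := by
  ext x
  constructor
  · rintro ⟨g, rfl⟩
    refine ⟨(LinearEquiv.map_ne_zero_iff g.1).mpr (by simp), ?_⟩
    exact (g.2 _).trans (by simp [hyp_apply])
  · rintro ⟨hx, h0⟩
    obtain ⟨r, hr, hre⟩ := exists_reflections_apply_eq hQ.hyp (x := ((1, 0), 0)) (by simp) hx
      (by simp [hyp_apply]) h0
    exact ⟨⟨r, closure_reflections_le hr⟩, hre⟩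

lemma card_stabilizer_isom_hyp (Q : QuadraticForm F V) :
    Nat.card (MulAction.stabilizer (isom (hyp Q)) (((1, 0), 0) : (F × F) × V)) =
      Nat.card V * Nat.card (isom Q) := by
  let T : V × isom Q → MulAction.stabilizer (isom (hyp Q)) (((1, 0), 0) : (F × F) × V) :=
    fun y => ⟨⟨eichler Q (.ofAdd y.1) * extHyp y.2.1,
      mul_mem (eichler_mem_isom _) (extHyp_mem_isom y.2.2)⟩, by
        change eichler Q (.ofAdd y.1) (extHyp y.2.1 ((1, 0), 0)) = ((1, 0), 0)
        simp [extHyp_apply, eichler_apply]⟩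
  have hT : Function.Bijective T := by
    constructor
    · rintro ⟨v, h⟩ ⟨v', h'⟩ hvh
      have hvh : eichler Q (.ofAdd v) * extHyp h.1 = eichler Q (.ofAdd v') * extHyp h'.1 :=
        congrArg (fun g => g.1.1) hvh
      have hv : v = v' := by
        simpa [extHyp_apply, eichler_apply] using
          congrArg Prod.snd (LinearEquiv.congr_fun hvh ((0, 1), 0))
      subst hv
      rw [Subtype.ext (extHyp_injective (mul_left_cancel hvh))]
    · rintro ⟨⟨g, hg⟩, he⟩
      obtain ⟨v, h, hh, rfl⟩ := exists_eichler_mul_extHyp hg he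
      exact ⟨(v.toAdd, ⟨h, hh⟩), rfl⟩
  rw [← Nat.card_congr (Equiv.ofBijective T hT), Nat.card_prod]

theorem card_isom_hyp (hQ : Regular Q) : Nat.card (isom (hyp Q)) =
    {x | x ≠ 0 ∧ hyp Q x = 0}.ncard * Nat.card V * Nat.card (isom Q) := by
  rw [← Subgroup.card_mul_index (MulAction.stabilizer _ (((1, 0), 0) : (F × F) × V)),
    MulAction.index_stabilizer, orbit_isom_hyp hQ, card_stabilizer_isom_hyp]
  ring

lemma card_zeros_hyp_fst_eq_zero (Q : QuadraticForm F V) :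
    Nat.card {x : (F × F) × V // hyp Q x = 0 ∧ x.1.1 = 0} =
      Nat.card F * Nat.card {v : V // Q v = 0} := by
  rw [← Nat.card_prod]
  refine Nat.card_congr
    { toFun := fun x => (x.1.1.2, ⟨x.1.2, ?_⟩)
      invFun := fun y => ⟨((0, y.1), y.2), by simp [hyp_apply, y.2.2]⟩
      left_inv := fun x => Subtype.ext (Prod.ext (Prod.ext x.2.2.symm rfl) rfl)
      right_inv := fun y => rfl }
  simpa [hyp_apply, x.2.2] using x.2.1

lemma card_zeros_hyp_fst_ne_zero (Q : QuadraticForm F V) :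
    Nat.card {x : (F × F) × V // hyp Q x = 0 ∧ ¬ x.1.1 = 0} =
      (Nat.card F - 1) * Nat.card V := by
  rw [← Nat.card_units, ← Nat.card_prod]
  refine Nat.card_congr
    { toFun := fun x => (Units.mk0 x.1.1.1 x.2.2, x.1.2)
      invFun := fun y => ⟨((y.1, -Q y.2 / y.1), y.2), by simp [hyp_apply, mul_div_cancel₀]⟩
      left_inv := fun x => Subtype.ext (Prod.ext (Prod.ext rfl ?_) rfl)
      right_inv := fun y => by simp }
  have h : x.1.1.1 * x.1.1.2 + Q x.1.2 = 0 := hyp_apply (Q := Q) x.1 ▸ x.2.1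
  exact (div_eq_iff x.2.2).mpr ((eq_neg_of_add_eq_zero_left h).symm.trans (mul_comm _ _))

theorem card_zeros_hyp [Finite F] [Finite V] (Q : QuadraticForm F V) :
    Nat.card {x : (F × F) × V // hyp Q x = 0} =
      (Nat.card F - 1) * Nat.card V + Nat.card F * Nat.card {v : V // Q v = 0} := by
  classical
  rw [← card_zeros_hyp_fst_eq_zero, ← card_zeros_hyp_fst_ne_zero, add_comm, ← Nat.card_sum]
  exact Nat.card_congr ((Equiv.sumCompl fun x : {x : (F × F) × V // hyp Q x = 0} =>
    x.1.1.1 = 0).symm.trans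
      ((Equiv.subtypeSubtypeEquivSubtypeInter _ fun x : (F × F) × V => x.1.1 = 0).sumCongr
        (Equiv.subtypeSubtypeEquivSubtypeInter _ fun x : (F × F) × V => ¬ x.1.1 = 0)))

end Hyperbolic

section Forms

open QuadraticMap

variable {F : Type*} [Field F]

lemma plusForm_apply (m : ℕ) (x : Fin m ⊕ Fin m → F) :
    plusForm F m x = ∑ i, x (.inl i) * x (.inr i) := by
  simp [plusForm]

lemma addPlusForm_apply {a : ℕ} (N : QuadraticForm F (Fin a → F)) (m : ℕ)
    (x : Fin a ⊕ (Fin m ⊕ Fin m) → F) :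
    addPlusForm N m x = N (fun i => x (.inl i)) +
      ∑ i, x (.inr (.inl i)) * x (.inr (.inr i)) := by
  simp only [addPlusForm, _root_.add_apply, QuadraticMap.comp_apply, plusForm_apply]
  rfl

/-- The isometry splitting the first hyperbolic plane off `addPlusForm N (m + 1)`. -/
def addPlusFormSucc {a : ℕ} (N : QuadraticForm F (Fin a → F)) (m : ℕ) :
    (addPlusForm N (m + 1)).IsometryEquiv (hyp (addPlusForm N m)) where
  toFun x := ((x (.inr (.inl 0)), x (.inr (.inr 0))),
    Sum.elim (fun i => x (.inl i)) (Sum.elim (fun i => x (.inr (.inl i.succ)))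
      (fun i => x (.inr (.inr i.succ)))))
  invFun y := Sum.elim (fun i => y.2 (.inl i)) (Sum.elim
    (Fin.cons y.1.1 fun i => y.2 (.inr (.inl i))) (Fin.cons y.1.2 fun i => y.2 (.inr (.inr i))))
  map_add' x y := by
    refine Prod.ext rfl (funext ?_)
    rintro (i | i | i) <;> rfl
  map_smul' c x := by
    refine Prod.ext rfl (funext ?_)
    rintro (i | i | i) <;> rfl
  left_inv x := by
    funext i
    rcases i with i | i | i
    · rfl
    · refine Fin.cases ?_ (fun i => ?_) i <;> rfl
    · refine Fin.cases ?_ (fun i => ?_) i <;> rfl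
  right_inv y := by
    refine Prod.ext rfl (funext ?_)
    rintro (i | i | i) <;> rfl
  map_app' x := by
    rw [hyp_apply, addPlusForm_apply, addPlusForm_apply, Fin.sum_univ_succ]
    simp only [Sum.elim_inl, Sum.elim_inr]
    ring

/-- Adding no hyperbolic planes to `N` does not change it. -/
def addPlusFormZero {a : ℕ} (N : QuadraticForm F (Fin a → F)) :
    (addPlusForm N 0).IsometryEquiv N where
  toFun x i := x (.inl i)
  invFun y := Sum.elim y (Sum.elim Fin.elim0 Fin.elim0)
  map_add' x y := rfl
  map_smul' c x := rfl
  left_inv x := by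
    funext i
    rcases i with i | i | i
    · rfl
    · exact i.elim0
    · exact i.elim0
  right_inv y := rfl
  map_app' x := by simp [addPlusForm_apply]

/-- The split form is the orthogonal sum of itself and the form in no variables. -/
def plusFormEquiv (m : ℕ) :
    (plusForm F m).IsometryEquiv (addPlusForm (0 : QuadraticForm F (Fin 0 → F)) m) where
  toFun x := Sum.elim Fin.elim0 x
  invFun y i := y (.inr i)
  map_add' x y := by
    funext i
    rcases i with i | i
    · exact i.elim0
    · rfl
  map_smul' c x := by
    funext i
    rcases i with i | i
    · exact i.elim0
    · rfl
  left_inv x := rfl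
  right_inv y := by
    funext i
    rcases i with i | i
    · exact i.elim0
    · rfl
  map_app' x := by simp [addPlusForm_apply, plusForm_apply]

variable {a : ℕ} {N : QuadraticForm F (Fin a → F)}

lemma regular_of_anisotropic {V : Type*} [AddCommGroup V] [Module F V] {Q : QuadraticForm F V}
    (hQ : Q.Anisotropic) : Regular Q :=
  fun x _ h => hQ x h

lemma generatedBy_of_anisotropic {V : Type*} [AddCommGroup V] [Module F V] [Finite V]
    {Q : QuadraticForm F V} (hQ : Q.Anisotropic) (p : ℕ) : GeneratedBy p Q :=
  (isom_le_closure_of_anisotropic hQ).trans (Subgroup.closure_mono Set.subset_union_left)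

lemma regular_addPlusForm (hN : N.Anisotropic) (m : ℕ) : Regular (addPlusForm N m) := by
  induction m with
  | zero => exact (regular_of_anisotropic hN).of_isometryEquiv (addPlusFormZero N).symm
  | succ m ih => exact ih.hyp.of_isometryEquiv (addPlusFormSucc N m).symm

lemma generatedBy_addPlusForm [Finite F] (p : ℕ) [CharP F p] (hN : N.Anisotropic) (m : ℕ) :
    GeneratedBy p (addPlusForm N m) := by
  induction m with
  | zero => exact (generatedBy_of_anisotropic hN p).of_isometryEquiv (addPlusFormZero N).symm
  | succ m ih =>
    exact (GeneratedBy.hyp (regular_addPlusForm hN m) ih).of_isometryEquiv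
      (addPlusFormSucc N m).symm

lemma card_zeros_of_anisotropic {V : Type*} [AddCommGroup V] [Module F V] {Q : QuadraticForm F V}
    (hQ : Q.Anisotropic) : Nat.card {x // Q x = 0} = 1 := by
  rw [Nat.card_eq_one_iff_unique]
  exact ⟨⟨fun x y => Subtype.ext ((hQ _ x.2).trans (hQ _ y.2).symm)⟩, ⟨0, QuadraticMap.map_zero Q⟩⟩

lemma card_zeros_addPlusForm_zero (hN : N.Anisotropic) :
    Nat.card {x // addPlusForm N 0 x = 0} = 1 := by
  rw [card_zeros_congr (addPlusFormZero N), card_zeros_of_anisotropic hN]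

lemma card_sum_fin_fun (F : Type*) (a m : ℕ) :
    Nat.card (Fin a ⊕ (Fin m ⊕ Fin m) → F) = Nat.card F ^ (a + 2 * m) := by
  rw [Nat.card_fun]
  simp [two_mul]

lemma card_zeros_addPlusForm_succ [Finite F] (m : ℕ) :
    Nat.card {x // addPlusForm N (m + 1) x = 0} = (Nat.card F - 1) * Nat.card F ^ (a + 2 * m) +
      Nat.card F * Nat.card {x // addPlusForm N m x = 0} := by
  rw [card_zeros_congr (addPlusFormSucc N m), card_zeros_hyp, card_sum_fin_fun]

lemma card_isom_addPlusForm_succ (hN : N.Anisotropic) (m : ℕ) :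
    Nat.card (isom (addPlusForm N (m + 1))) =
      (Nat.card {x // addPlusForm N (m + 1) x = 0} - 1) * Nat.card F ^ (a + 2 * m) *
        Nat.card (isom (addPlusForm N m)) := by
  rw [Nat.card_congr (isomCongr (addPlusFormSucc N m)).toEquiv,
    card_isom_hyp (regular_addPlusForm hN m), card_sum_fin_fun, ncard_ne_zero_zeros,
    card_zeros_congr (addPlusFormSucc N m)]

end Forms

section Anisotropic

open scoped LinearAlgebra.Projectivization

open Module QuadraticMap

lemma not_dvd_card_of_mul_self {G : Type*} [Group G] [Finite G] {l : ℕ} (hl : l.Prime)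
    (hl2 : l ≠ 2) (h : ∀ g : G, g * g = 1) : ¬ l ∣ Nat.card G := by
  intro hdvd
  have : Fact l.Prime := ⟨hl⟩
  obtain ⟨g, hg⟩ := exists_prime_orderOf_dvd_card' l hdvd
  have h2 : l ∣ 2 := hg ▸ orderOf_dvd_of_pow_eq_one ((pow_two g).trans (h g))
  exact hl2 ((Nat.prime_dvd_prime_iff_eq hl Nat.prime_two).mp h2)

variable {F : Type*} [Field F] {V : Type*} [AddCommGroup V] [Module F V] {N : QuadraticForm F V}

lemma orbit_isom_of_anisotropic (hN : N.Anisotropic) (v : V) :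
    MulAction.orbit (isom N) v = {w | N w = N v} := by
  ext w
  refine ⟨?_, fun hw => ?_⟩
  · rintro ⟨g, rfl⟩
    exact g.2 v
  · by_cases hwv : w = v
    · exact hwv ▸ MulAction.mem_orbit_self w
    · have hne : N (w - v) ≠ 0 := hN.eq_zero_iff.not.mpr (sub_ne_zero.mpr hwv)
      exact ⟨⟨_, reflEquiv_mem_isom hne⟩, reflEquiv_sub_apply hw.symm hne⟩

-- An isometry fixing a hyperplane pointwise and moving `x` is the reflection along `g x - x`.
lemma mul_self_of_apply_eq (hN : N.Anisotropic) {g : V ≃ₗ[F] V} (hg : g ∈ isom N) {s : Set V}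
    {x : V} (hs : Submodule.span F (insert x s) = ⊤) (h : ∀ v ∈ s, g v = v) : g * g = 1 := by
  have hext : ∀ f : V ≃ₗ[F] V, f x = g x → (∀ v ∈ s, f v = v) → f = g := fun f hx hf =>
    LinearEquiv.toLinearMap_injective (LinearMap.ext_on hs (by
      rintro v (rfl | hv)
      · exact hx
      · exact (hf v hv).trans (h v hv).symm))
  by_cases hx : g x = x
  · rw [← hext 1 hx.symm fun _ _ => rfl, one_mul]
  · have hne : N (g x - x) ≠ 0 := hN.eq_zero_iff.not.mpr (sub_ne_zero.mpr hx)
    rw [← hext (reflEquiv N _ hne) (reflEquiv_sub_apply (hg x).symm hne) fun v hv => ?_]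
    · exact reflEquiv_mul_self hne
    · have hv0 : polar N (g x - x) v = 0 := by
        rw [polar_sub_left, sub_eq_zero, ← polar_of_mem_isom hg x v, h v hv]
      rw [reflEquiv_apply, hv0, mul_zero, zero_smul, sub_zero]

lemma isom_mul_self_of_finrank_eq_one (hN : N.Anisotropic) (hV : finrank F V = 1) (g : isom N) :
    g * g = 1 := by
  obtain ⟨x, -, hx⟩ := finrank_eq_one_iff'.mp hV
  refine Subtype.ext (mul_self_of_apply_eq hN g.2 (s := ∅) (x := x) ?_ fun v hv => hv.elim)
  exact eq_top_iff.mpr fun w _ => by simpa [Submodule.mem_span_singleton] using hx w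

lemma exists_polar_ne_zero [Finite F] (hN : N.Anisotropic) (hV : 1 < finrank F V) {v : V}
    (hv : v ≠ 0) : ∃ w, polar N v w ≠ 0 := by
  by_contra! h
  have hNv : N v ≠ 0 := hN.eq_zero_iff.not.mpr hv
  have h2 : (2 : F) = 0 := by
    have := h v
    rw [polar_self, nsmul_eq_mul] at this
    exact_mod_cast (mul_eq_zero.mp this).resolve_right hNv
  have : CharP F 2 := CharTwo.of_one_ne_zero_of_two_eq_zero one_ne_zero h2
  obtain ⟨w, hw⟩ := exists_linearIndependent_pair_of_one_lt_finrank hV hv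
  -- In characteristic two, `N w + s ^ 2 * N v` is the value of `N` at `w + s • v`.
  obtain ⟨s, hs⟩ := FiniteField.isSquare_of_char_two (ringChar.eq F 2) (N w / N v)
  have hws : w + s • v = 0 := by
    refine hN _ ?_
    rw [map_add_smul, polar_comm, h w, ← hs, mul_zero, add_zero, div_mul_cancel₀ _ hNv,
      CharTwo.add_self_eq_zero]
  exact (LinearIndependent.pair_iff' hv).mp hw (-s)
    (by rw [neg_smul, eq_neg_of_add_eq_zero_left hws])

lemma reflEquiv_smul {v : V} (hv : N v ≠ 0) {s : F} (hsv : N (s • v) ≠ 0) :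
    reflEquiv N (s • v) hsv = reflEquiv N v hv := by
  have hs : s ≠ 0 := by
    rintro rfl
    simp at hsv
  refine LinearEquiv.ext fun y => ?_
  rw [reflEquiv_apply, reflEquiv_apply, QuadraticMap.map_smul, polar_smul_left, smul_smul]
  congr 2
  simp only [smul_eq_mul]
  field_simp

/-- The image of `v` under the reflection along a point of the projective space of `V`; it depends
only on the point by `reflEquiv_smul`. -/
def reflAlong (hN : N.Anisotropic) (v : V) (P : ℙ F V) : {w // N w = N v} :=
  ⟨reflEquiv N P.rep (hN.eq_zero_iff.not.mpr P.rep_nonzero) v, reflEquiv_mem_isom _ v⟩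

lemma span_pair_eq_top (hV : finrank F V = 2) {v w : V} (h : LinearIndependent F ![v, w]) :
    Submodule.span F {v, w} = ⊤ := by
  rw [← Matrix.range_cons_cons_empty v w ![],
    h.span_eq_top_of_card_eq_finrank ((Fintype.card_fin 2).trans hV.symm)]

lemma reflAlong_injective [Finite F] (hN : N.Anisotropic) (hV : finrank F V = 2) {v : V}
    (hv : v ≠ 0) : Function.Injective (reflAlong hN v) := by
  intro P P' h
  by_contra hPP'
  have hli : LinearIndependent F ![P.rep, P'.rep] :=
    Projectivization.linearIndependent_pair_iff_ne.mpr hPP'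
  have heq : ((N P.rep)⁻¹ * polar N P.rep v) • P.rep =
      ((N P'.rep)⁻¹ * polar N P'.rep v) • P'.rep :=
    sub_right_injective (by simpa only [reflAlong, reflEquiv_apply] using congrArg Subtype.val h)
  obtain ⟨h0, h0'⟩ := LinearIndependent.pair_iff.mp hli ((N P.rep)⁻¹ * polar N P.rep v)
    (-((N P'.rep)⁻¹ * polar N P'.rep v)) (by rw [neg_smul, heq, add_neg_cancel])
  have hpolar : ∀ P : ℙ F V, (N P.rep)⁻¹ * polar N P.rep v = 0 → N.polarBilin v P.rep = 0 :=
    fun P h => (polar_comm _ _ _).trans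
      (eq_zero_of_ne_zero_of_mul_left_eq_zero
        (inv_ne_zero (hN.eq_zero_iff.not.mpr P.rep_nonzero)) h)
  have hv0 : N.polarBilin v = 0 := LinearMap.ext_on (span_pair_eq_top hV hli) (by
    rintro _ (rfl | rfl)
    · exact hpolar P h0
    · exact hpolar P' (neg_eq_zero.mp h0'))
  obtain ⟨w, hw⟩ := exists_polar_ne_zero hN (hV ▸ one_lt_two) hv
  exact hw (LinearMap.congr_fun hv0 w)

lemma reflAlong_surjective (hN : N.Anisotropic) (hV : 1 < finrank F V) (v : V) :
    Function.Surjective (reflAlong hN v) := by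
  rintro ⟨w, hw⟩
  suffices ∃ (x : V) (hx : x ≠ 0), reflEquiv N x (hN.eq_zero_iff.not.mpr hx) v = w by
    obtain ⟨x, hx, rfl⟩ := this
    obtain ⟨a, ha⟩ := Projectivization.exists_smul_eq_mk_rep F x hx
    refine ⟨.mk F x hx, Subtype.ext ?_⟩
    simp only [reflAlong, ← ha, Units.smul_def, reflEquiv_smul (hN.eq_zero_iff.not.mpr hx)]
  by_cases hwv : w = v
  · have : FiniteDimensional F V := .of_finrank_pos (zero_lt_one.trans hV)
    obtain ⟨x, hx, hx0⟩ := (Submodule.ne_bot_iff _).mp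
      (LinearMap.ker_ne_bot_of_finrank_lt (f := N.polarBilin v) (by simpa using hV))
    have hxv : polar N x v = 0 := (polar_comm _ _ _).trans hx
    exact ⟨x, hx0, by rw [reflEquiv_apply, hxv, mul_zero, zero_smul, sub_zero, hwv]⟩
  · exact ⟨w - v, sub_ne_zero.mpr hwv, reflEquiv_sub_apply hw.symm _⟩

lemma card_level [Finite F] (hN : N.Anisotropic) (hV : finrank F V = 2) {v : V} (hv : v ≠ 0) :
    Nat.card {w // N w = N v} = Nat.card F + 1 := by
  rw [← Projectivization.card_of_finrank_two F V hV]
  exact (Nat.card_eq_of_bijective _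
    ⟨reflAlong_injective hN hV hv, reflAlong_surjective hN (hV ▸ one_lt_two) v⟩).symm

theorem factorization_card_isom_binary [Finite F] (hN : N.Anisotropic) (hV : finrank F V = 2)
    {l : ℕ} (hl : l.Prime) (hl2 : l ≠ 2) :
    (Nat.card (isom N)).factorization l = (Nat.card F + 1).factorization l := by
  have : FiniteDimensional F V := .of_finrank_eq_succ hV
  have : Finite V := Module.finite_of_finite F
  have : Nontrivial V := Module.nontrivial_of_finrank_eq_succ hV
  obtain ⟨v, hv⟩ := exists_ne (0 : V)
  have hindex : (MulAction.stabilizer (isom N) v).index = Nat.card F + 1 := by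
    rw [MulAction.index_stabilizer, orbit_isom_of_anisotropic hN, ← Nat.card_coe_set_eq]
    exact card_level hN hV hv
  have hstab : ¬ l ∣ Nat.card (MulAction.stabilizer (isom N) v) := by
    obtain ⟨x, hx⟩ := exists_linearIndependent_pair_of_one_lt_finrank (hV ▸ one_lt_two) hv
    refine not_dvd_card_of_mul_self hl hl2 fun g => Subtype.ext (Subtype.ext ?_)
    refine mul_self_of_apply_eq hN g.1.2 (s := {v}) (x := x) ?_ fun _ hw => ?_
    · rw [Set.pair_comm, span_pair_eq_top hV hx]
    · exact hw ▸ g.2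
  rw [← Subgroup.card_mul_index (MulAction.stabilizer (isom N) v), hindex,
    Nat.factorization_mul Nat.card_pos.ne' (Nat.succ_ne_zero _), Finsupp.add_apply,
    Nat.factorization_eq_zero_of_not_dvd hstab, zero_add]

end Anisotropic

section Arithmetic

variable {q l : ℕ}

lemma factorization_mul_of_not_dvd {b : ℕ} (hb : ¬ l ∣ b) (n : ℕ) :
    (b * n).factorization l = n.factorization l := by
  rcases eq_or_ne n 0 with rfl | hn
  · rw [mul_zero]
  · have hb0 : b ≠ 0 := fun h => hb (h ▸ dvd_zero l)
    rw [Nat.factorization_mul hb0 hn, Finsupp.add_apply,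
      Nat.factorization_eq_zero_of_not_dvd hb, zero_add]

lemma factorization_pow_two_mul_sub_one (hq : 1 < q) {j : ℕ} (hj : 0 < j) :
    (q ^ (2 * j) - 1).factorization l =
      (q ^ j - 1).factorization l + (q ^ j + 1).factorization l := by
  have hqj : 1 < q ^ j := Nat.one_lt_pow hj.ne' hq
  have hsq : q ^ (2 * j) - 1 = (q ^ j + 1) * (q ^ j - 1) := by
    rw [← Nat.sq_sub_sq, one_pow, ← pow_mul, mul_comm]
  rw [hsq, Nat.factorization_mul (by omega) (by omega), Finsupp.add_apply, add_comm]

end Arithmetic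

section Orders

variable {F : Type*} [Field F]

lemma anisotropic_smul_proj {c : F} (hc : c ≠ 0) :
    (c • QuadraticMap.proj (R := F) (A := F) (n := Fin 1) 0 0).Anisotropic := by
  intro x hx
  have hx0 : x 0 = 0 := by simpa [hc] using hx
  exact funext fun i => Subsingleton.elim i 0 ▸ hx0

variable [Finite F]

lemma card_zeros_addPlusForm {a : ℕ} {N : QuadraticForm F (Fin a → F)} (hN : N.Anisotropic)
    (m : ℕ) : (Nat.card F * Nat.card {x // addPlusForm N m x = 0} : ℤ) =
      Nat.card F ^ (a + 2 * m) + Nat.card F ^ (m + 1) - Nat.card F ^ (a + m) := by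
  induction m with
  | zero => simp [card_zeros_addPlusForm_zero hN]
  | succ m ih =>
    rw [card_zeros_addPlusForm_succ]
    push_cast [Nat.cast_pred (Nat.card_pos (α := F))]
    linear_combination (Nat.card F : ℤ) * ih

lemma card_mul_card_zeros_addPlusForm_sub_one {a : ℕ} {N : QuadraticForm F (Fin a → F)}
    (hN : N.Anisotropic) (m : ℕ) :
    Nat.card F * (Nat.card {x // addPlusForm N m x = 0} - 1) =
      (Nat.card F ^ m - 1) * (Nat.card F ^ (a + m) + Nat.card F) := by
  have : Nonempty {x // addPlusForm N m x = 0} := ⟨0, QuadraticMap.map_zero _⟩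
  have hzeros : 1 ≤ Nat.card {x // addPlusForm N m x = 0} := Nat.card_pos
  zify [hzeros, Nat.one_le_pow m _ (Nat.card_pos (α := F))]
  linear_combination card_zeros_addPlusForm hN m

variable {l : ℕ} (hl : l.Prime) (hq : ¬ l ∣ Nat.card F)
include hl hq

lemma factorization_isom_addPlusForm_succ {a : ℕ} {N : QuadraticForm F (Fin a → F)}
    (hN : N.Anisotropic) (m : ℕ) :
    (Nat.card (isom (addPlusForm N (m + 1)))).factorization l =
      (Nat.card (isom (addPlusForm N m))).factorization l +
        ((Nat.card F ^ (m + 1) - 1).factorization l +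
          (Nat.card F ^ (a + m) + 1).factorization l) := by
  have hpow : Nat.card F ^ (m + 1) - 1 ≠ 0 :=
    (Nat.sub_pos_of_lt (Nat.one_lt_pow m.succ_ne_zero Finite.one_lt_card)).ne'
  have hzeros : Nat.card {x // addPlusForm N (m + 1) x = 0} - 1 =
      (Nat.card F ^ (m + 1) - 1) * (Nat.card F ^ (a + m) + 1) := by
    refine Nat.eq_of_mul_eq_mul_left (Nat.card_pos (α := F)) ?_
    rw [card_mul_card_zeros_addPlusForm_sub_one hN]
    ring
  have hq' : ¬ l ∣ Nat.card F ^ (a + 2 * m) := fun h => hq (hl.dvd_of_dvd_pow h)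
  rw [card_isom_addPlusForm_succ hN, hzeros, mul_right_comm, mul_comm,
    factorization_mul_of_not_dvd hq', mul_comm,
    Nat.factorization_mul Nat.card_pos.ne' (mul_ne_zero hpow (Nat.succ_ne_zero _)),
    Finsupp.add_apply, Nat.factorization_mul hpow (Nat.succ_ne_zero _), Finsupp.add_apply]

lemma factorization_isom_addPlusForm {a : ℕ} {N : QuadraticForm F (Fin a → F)}
    (hN : N.Anisotropic) (m : ℕ) :
    (Nat.card (isom (addPlusForm N m))).factorization l = (Nat.card (isom N)).factorization l +
      ∑ j ∈ Finset.range m, ((Nat.card F ^ (j + 1) - 1).factorization l +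
        (Nat.card F ^ (a + j) + 1).factorization l) := by
  induction m with
  | zero =>
    rw [Finset.sum_range_zero, Nat.card_congr (isomCongr (addPlusFormZero N)).toEquiv, add_zero]
  | succ m ih =>
    rw [Finset.sum_range_succ, ← add_assoc, ← ih, factorization_isom_addPlusForm_succ hl hq hN]

lemma factorization_GL (n : ℕ) : (Nat.card (GL (Fin n) F)).factorization l =
    ∑ j ∈ Finset.range n, (Nat.card F ^ (j + 1) - 1).factorization l := by
  have := Fintype.ofFinite F
  have hpow : ∀ j, Nat.card F ^ (j + 1) - 1 ≠ 0 := fun j =>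
    (Nat.sub_pos_of_lt (Nat.one_lt_pow j.succ_ne_zero Finite.one_lt_card)).ne'
  have hfactor : ∀ i : Fin n, Nat.card F ^ n - Nat.card F ^ (i : ℕ) =
      Nat.card F ^ (i : ℕ) * (Nat.card F ^ (n - 1 - i + 1) - 1) := fun i => by
    rw [Nat.mul_sub, mul_one, ← pow_add]
    congr 2
    omega
  simp_rw [Matrix.card_GL_field, ← Nat.card_eq_fintype_card, hfactor]
  rw [Nat.factorization_prod fun i _ => mul_ne_zero (pow_ne_zero _ Nat.card_pos.ne') (hpow _),
    Finsupp.finsetSum_apply, ← Finset.sum_range_reflect, Finset.sum_range]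
  exact Finset.sum_congr rfl fun i _ =>
    factorization_mul_of_not_dvd (fun h => hq (hl.dvd_of_dvd_pow h)) _

lemma factorization_isom_oddForm (hl2 : l ≠ 2) {c : F} (hc : c ≠ 0) (m : ℕ) :
    (Nat.card (isom (oddForm c m))).factorization l =
      ∑ j ∈ Finset.range m, (Nat.card F ^ (2 * (j + 1)) - 1).factorization l := by
  have hN := anisotropic_smul_proj hc
  have h1 := Nat.factorization_eq_zero_of_not_dvd
    (not_dvd_card_of_mul_self hl hl2 (isom_mul_self_of_finrank_eq_one hN (by simp)))
  rw [oddForm, factorization_isom_addPlusForm hl hq hN, h1, zero_add]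
  refine Finset.sum_congr rfl fun j _ => ?_
  rw [factorization_pow_two_mul_sub_one Finite.one_lt_card j.succ_pos, add_comm 1]

lemma factorization_isom_plusForm_add (hl2 : l ≠ 2) (m : ℕ) :
    (Nat.card (isom (plusForm F m))).factorization l + (Nat.card F ^ m + 1).factorization l =
      ∑ j ∈ Finset.range m, (Nat.card F ^ (2 * (j + 1)) - 1).factorization l := by
  have hN : (0 : QuadraticForm F (Fin 0 → F)).Anisotropic := fun x _ => Subsingleton.elim _ _
  have : Subsingleton (isom (0 : QuadraticForm F (Fin 0 → F))) :=
    ⟨fun g h => Subtype.ext (LinearEquiv.ext fun x => Subsingleton.elim _ _)⟩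
  have h2 : (Nat.card F ^ 0 + 1).factorization l = 0 :=
    Nat.factorization_eq_zero_of_not_dvd fun h =>
      hl2 ((Nat.prime_dvd_prime_iff_eq hl Nat.prime_two).mp h)
  rw [Nat.card_congr (isomCongr (plusFormEquiv m)).toEquiv,
    factorization_isom_addPlusForm hl hq hN, Nat.card_of_subsingleton 1, Nat.factorization_one,
    Finsupp.zero_apply, zero_add]
  simp only [zero_add, Finset.sum_add_distrib]
  rw [add_assoc, ← Finset.sum_range_succ, Finset.sum_range_succ', h2, add_zero,
    ← Finset.sum_add_distrib]
  exact Finset.sum_congr rfl fun j _ =>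
    (factorization_pow_two_mul_sub_one Finite.one_lt_card j.succ_pos).symm

lemma factorization_isom_addPlusForm_two_add (hl2 : l ≠ 2) {N : QuadraticForm F (Fin 2 → F)}
    (hN : N.Anisotropic) (m : ℕ) :
    (Nat.card (isom (addPlusForm N m))).factorization l +
        (Nat.card F ^ (m + 1) - 1).factorization l =
      ∑ j ∈ Finset.range (m + 1), (Nat.card F ^ (2 * (j + 1)) - 1).factorization l := by
  have hsum : ∀ j ∈ Finset.range (m + 1), (Nat.card F ^ (2 * (j + 1)) - 1).factorization l =
      (Nat.card F ^ (j + 1) - 1).factorization l + (Nat.card F ^ (j + 1) + 1).factorization l :=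
    fun j _ => factorization_pow_two_mul_sub_one Finite.one_lt_card j.succ_pos
  rw [factorization_isom_addPlusForm hl hq hN,
    factorization_card_isom_binary hN (by simp) hl hl2, Finset.sum_congr rfl hsum,
    Finset.sum_add_distrib, Finset.sum_add_distrib, Finset.sum_range_succ,
    Finset.sum_range_succ' fun j => (Nat.card F ^ (j + 1) + 1).factorization l, zero_add, pow_one]
  simp only [add_comm 2]
  ring

end Orders

section Commutator

variable {G : Type*} [Group G]

/-- The elements of `S` whose class in the abelianization of `S` has order prime to `l`, as a
subgroup of the ambient group. -/
def coprimePart (S : Subgroup G) [S.Normal] (l : ℕ) : Subgroup G where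
  carrier := {g | g ∈ S ∧ ∃ M : ℕ, M.Coprime l ∧ g ^ M ∈ ⁅S, S⁆}
  one_mem' := ⟨one_mem S, 1, Nat.coprime_one_left l, by rw [one_pow]; exact one_mem _⟩
  inv_mem' := by
    rintro g ⟨hg, M, hM, h⟩
    exact ⟨inv_mem hg, M, hM, by rw [inv_pow]; exact inv_mem h⟩
  mul_mem' := by
    rintro g h ⟨hg, M, hM, hgM⟩ ⟨hh, N, hN, hhN⟩
    refine ⟨mul_mem hg hh, M * N, Nat.Coprime.mul_left hM hN, ?_⟩
    have hcomm : Commute (QuotientGroup.mk' ⁅S, S⁆ g) (QuotientGroup.mk' ⁅S, S⁆ h) := by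
      rw [← commutatorElement_eq_one_iff_commute, ← map_commutatorElement, QuotientGroup.mk'_apply,
        QuotientGroup.eq_one_iff]
      exact Subgroup.commutator_mem_commutator hg hh
    rw [← QuotientGroup.eq_one_iff, ← QuotientGroup.mk'_apply, map_pow] at hgM hhN ⊢
    rw [map_mul, hcomm.mul_pow, pow_mul, hgM, one_pow, mul_comm M, pow_mul, hhN, one_pow, one_mul]

instance (S : Subgroup G) [S.Normal] (l : ℕ) : (coprimePart S l).Normal where
  conj_mem := by
    rintro g ⟨hg, M, hM, h⟩ x
    refine ⟨Subgroup.Normal.conj_mem inferInstance g hg x, M, hM, ?_⟩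
    rw [conj_pow]
    exact Subgroup.Normal.conj_mem inferInstance _ h x

lemma mem_coprimePart_of_pow_eq_one {S : Subgroup G} [S.Normal] {l M : ℕ} {g : G} (hg : g ∈ S)
    (hM : M.Coprime l) (h : g ^ M = 1) : g ∈ coprimePart S l :=
  ⟨hg, M, hM, by rw [h]; exact one_mem _⟩

lemma mul_self_mem_of_closure_eq_top {N : Subgroup G} [N.Normal] {R : Set G}
    (hR : Subgroup.closure R = ⊤) {r₀ : G} (h₀ : r₀ * r₀ ∈ N)
    (h : ∀ r ∈ R, r ∈ N ∨ r * r₀⁻¹ ∈ N) (g : G) : g * g ∈ N := by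
  let π := QuotientGroup.mk' N
  have hπ : ∀ g, π g = 1 ↔ g ∈ N := QuotientGroup.eq_one_iff
  have hcyclic : Subgroup.closure R ≤ (Subgroup.zpowers (π r₀)).comap π := by
    rw [Subgroup.closure_le]
    intro r hr
    rw [SetLike.mem_coe, Subgroup.mem_comap]
    rcases h r hr with h | h
    · rw [(hπ r).mpr h]
      exact one_mem _
    · rw [← hπ, map_mul, map_inv, mul_inv_eq_one] at h
      rw [h]
      exact Subgroup.mem_zpowers _
  obtain ⟨n, hn⟩ := Subgroup.mem_zpowers_iff.mp (hcyclic (hR.ge (Subgroup.mem_top g)))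
  rw [← hπ, map_mul, ← hn, ← (Commute.refl (π r₀)).mul_zpow, ← map_mul, (hπ _).mpr h₀, one_zpow]

/-- Modulo `coprimePart S l` the group is cyclic of order at most two. -/
theorem not_dvd_index_commutator [Finite G] (S : Subgroup G) [S.Normal] {l : ℕ} (hl : l.Prime)
    (hl2 : l ≠ 2) {R : Set G} (hR : Subgroup.closure R = ⊤) (r₀ : G)
    (h₀ : r₀ * r₀ ∈ coprimePart S l)
    (h : ∀ r ∈ R, r ∈ coprimePart S l ∨ r * r₀⁻¹ ∈ coprimePart S l) : ¬ l ∣ ⁅S, S⁆.index := by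
  have : Fact l.Prime := ⟨hl⟩
  intro hdvd
  rw [Subgroup.index_eq_card] at hdvd
  obtain ⟨x, hx⟩ := exists_prime_orderOf_dvd_card' l hdvd
  obtain ⟨g, rfl⟩ := QuotientGroup.mk_surjective x
  obtain ⟨-, M, hM, hgM⟩ := mul_self_mem_of_closure_eq_top hR h₀ h g
  rw [← pow_two, ← pow_mul, ← QuotientGroup.eq_one_iff, QuotientGroup.mk_pow] at hgM
  have hdvd := orderOf_dvd_of_pow_eq_one hgM
  rw [hx, hl.dvd_mul] at hdvd
  rcases hdvd with hdvd | hdvd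
  · exact hl2 ((Nat.prime_dvd_prime_iff_eq hl Nat.prime_two).mp hdvd)
  · exact hl.not_dvd_one (hM ▸ Nat.dvd_gcd hdvd dvd_rfl)

end Commutator

section Rotations

open QuadraticMap

variable {F : Type*} [Field F] {V : Type*} [AddCommGroup V] [Module F V]
  {Q : QuadraticForm F V}

/-- The isometries of determinant one, as a subgroup of the isometry group. -/
abbrev rotations (Q : QuadraticForm F V) : Subgroup (isom Q) :=
  (LinearEquiv.det.comp (isom Q).subtype).ker

lemma mem_rotations {g : isom Q} : g ∈ rotations Q ↔ LinearEquiv.det g.1 = 1 := Iff.rfl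

/-- A reflection as an element of the isometry group. -/
def reflIsom {v : V} (hv : Q v ≠ 0) : isom Q := ⟨reflEquiv Q v hv, reflEquiv_mem_isom hv⟩

lemma reflIsom_mul_self {v : V} (hv : Q v ≠ 0) : reflIsom hv * reflIsom hv = 1 :=
  Subtype.ext (reflEquiv_mul_self hv)

lemma det_reflIsom [FiniteDimensional F V] {v : V} (hv : Q v ≠ 0) :
    LinearEquiv.det (reflIsom hv).1 = -1 := by
  have htransvection : (reflEquiv Q v hv : V →ₗ[F] V) =
      LinearMap.transvection (-((Q v)⁻¹ • Q.polarBilin v)) v := by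
    refine LinearMap.ext fun y => ?_
    rw [LinearEquiv.coe_coe, reflEquiv_apply, LinearMap.transvection.apply]
    simp [sub_eq_add_neg]
  refine Units.ext ?_
  rw [LinearEquiv.coe_det, reflIsom, htransvection, LinearMap.transvection.det]
  simp only [LinearMap.neg_apply, LinearMap.smul_apply, polarBilin_apply_apply, polar_self,
    smul_eq_mul, nsmul_eq_mul, Units.val_neg, Units.val_one]
  field_simp
  norm_num

lemma reflIsom_commute {u w : V} (hu : Q u ≠ 0) (hw : Q w ≠ 0) (h : polar Q u w = 0) :
    Commute (reflIsom hu) (reflIsom hw) := by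
  refine Subtype.ext (LinearEquiv.ext fun y => ?_)
  simp only [reflIsom, Subgroup.coe_mul, LinearEquiv.mul_apply, reflEquiv_apply, polar_sub_right,
    polar_smul_right, h, polar_comm Q w u, smul_zero, sub_zero]
  abel

lemma GeneratedBy.closure_eq_top {p : ℕ} (h : GeneratedBy p Q) :
    Subgroup.closure ({g : isom Q | ∃ v, ∃ hv : Q v ≠ 0, g = reflIsom hv} ∪ {g | g ^ p = 1}) =
      ⊤ := by
  refine (Subgroup.eq_top_iff' _).mpr fun g => ?_
  have hle : Subgroup.closure (reflections Q ∪ {g | g ∈ isom Q ∧ g ^ p = 1}) ≤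
      (Subgroup.closure ({g : isom Q | ∃ v, ∃ hv : Q v ≠ 0, g = reflIsom hv} ∪
        {g | g ^ p = 1})).map (isom Q).subtype := by
    refine (Subgroup.closure_le _).mpr ?_
    rintro _ (⟨v, hv, rfl⟩ | ⟨hg, hp⟩)
    · exact ⟨reflIsom hv, Subgroup.subset_closure (Or.inl ⟨v, hv, rfl⟩), rfl⟩
    · exact ⟨⟨_, hg⟩, Subgroup.subset_closure (Or.inr (Subtype.ext hp)), rfl⟩
  exact (Subgroup.mem_map_iff_mem (isom Q).subtype_injective).mp (hle (h g.2))

lemma mem_coprimePart_of_pow_char_eq_one {p l : ℕ} (hp : p.Prime) [CharP F p] (hpl : p.Coprime l)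
    {g : isom Q} (hg : g ^ p = 1) : g ∈ coprimePart (rotations Q) l := by
  have : Fact p.Prime := ⟨hp⟩
  refine mem_coprimePart_of_pow_eq_one (mem_rotations.mpr (Units.ext ?_)) hpl hg
  have hdet : LinearEquiv.det g.1 ^ p = 1 := by
    rw [← map_pow, ← Subgroup.coe_pow, hg, Subgroup.coe_one, map_one]
  refine frobenius_inj F p ?_
  rw [frobenius_def, frobenius_def, ← Units.val_pow_eq_pow_val, hdet, Units.val_one, one_pow]

lemma mul_reflIsom_mem_coprimePart [FiniteDimensional F V] {l : ℕ} (h2l : Nat.Coprime 2 l)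
    {g : isom Q} (hg : g * g = 1) (hdet : LinearEquiv.det g.1 = -1) {v : V} (hv : Q v ≠ 0)
    (hc : Commute g (reflIsom hv)) : g * reflIsom hv ∈ coprimePart (rotations Q) l := by
  refine mem_coprimePart_of_pow_eq_one (mem_rotations.mpr ?_) h2l ?_
  · rw [Subgroup.coe_mul, map_mul, hdet, det_reflIsom, neg_mul_neg, one_mul]
  · rw [hc.mul_pow, pow_two, pow_two, hg, reflIsom_mul_self, one_mul]

lemma Regular.nondegenerate_polarBilin (hQ : Regular Q) (h2 : (2 : F) ≠ 0) :
    Q.polarBilin.Nondegenerate := by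
  have hrefl : Q.polarBilin.IsRefl := fun x y h => (polar_comm Q y x).trans h
  refine (LinearMap.IsRefl.nondegenerate_iff_separatingLeft hrefl).mpr fun x hx => hQ x hx ?_
  have hxx : polar Q x x = 0 := hx x
  rw [polar_self, nsmul_eq_mul] at hxx
  exact (mul_eq_zero.mp hxx).resolve_left (by exact_mod_cast h2)

lemma exists_orthogonal_nonsingular [FiniteDimensional F V] (hQ : Regular Q) (h2 : (2 : F) ≠ 0)
    (hdim : 4 ≤ Module.finrank F V) {u : V} (hu : Q u ≠ 0) (v : V) :
    ∃ w, Q w ≠ 0 ∧ polar Q u w = 0 ∧ polar Q v w = 0 := by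
  by_contra! hno
  let B : LinearMap.BilinForm F V := Q.polarBilin
  let U : Submodule F V := Submodule.span F {u, v}
  have hmemu : u ∈ U := Submodule.subset_span (Set.mem_insert u {v})
  have hmemv : v ∈ U := Submodule.subset_span (Set.mem_insert_of_mem u rfl)
  have hnondeg : B.Nondegenerate := hQ.nondegenerate_polarBilin h2
  have hsingular : ∀ w ∈ B.orthogonal U, Q w = 0 := fun w hw =>
    not_not.mp fun h => hno w h (hw u hmemu) (hw v hmemv)
  -- A totally singular subspace is contained in its orthogonal complement.
  have hle : B.orthogonal U ≤ U := by
    intro w hw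
    rw [← LinearMap.BilinForm.orthogonal_orthogonal hnondeg
      (fun x y h => (polar_comm Q y x).trans h) U]
    intro w' hw'
    change polar Q w' w = 0
    rw [polar, hsingular _ (add_mem hw' hw), hsingular _ hw, hsingular _ hw', sub_zero, sub_zero]
  have hU : Module.finrank F U ≤ 2 := by
    classical
    have hspan := finrank_span_finset_le_card (R := F) ({u, v} : Finset V)
    rw [Finset.coe_pair] at hspan
    exact hspan.trans Finset.card_le_two
  have hfinrank := LinearMap.BilinForm.finrank_orthogonal hnondeg U
  have heq : B.orthogonal U = U := Submodule.eq_of_le_of_finrank_le hle (by omega)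
  exact hu (hsingular u (heq.ge hmemu))

variable [Finite V] {p l : ℕ} [CharP F p]

theorem not_dvd_index_commutator_rotations_of_char_two [CharP F 2] (hl : l.Prime) (hl2 : l ≠ 2)
    (hgen : GeneratedBy 2 Q) : ¬ l ∣ ⁅rotations Q, rotations Q⁆.index := by
  have h2l : Nat.Coprime 2 l := (Nat.coprime_primes Nat.prime_two hl).mpr hl2.symm
  refine not_dvd_index_commutator _ hl hl2 hgen.closure_eq_top 1
    (by rw [one_mul]; exact one_mem _) fun g hg => Or.inl ?_
  refine mem_coprimePart_of_pow_char_eq_one Nat.prime_two h2l ?_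
  rcases hg with ⟨v, hv, rfl⟩ | hg
  · rw [pow_two, reflIsom_mul_self]
  · exact hg

theorem not_dvd_index_commutator_rotations_of_odd (hp : p.Prime)
    (hl : l.Prime) (hl2 : l ≠ 2) (hlp : l ≠ p) (hgen : GeneratedBy p Q)
    (hodd : Odd (Module.finrank F V)) : ¬ l ∣ ⁅rotations Q, rotations Q⁆.index := by
  let s : isom Q := ⟨LinearEquiv.neg F, fun x => QuadraticMap.map_neg Q x⟩
  have hs : s * s = 1 := Subtype.ext (LinearEquiv.ext neg_neg)
  have hcomm : ∀ g, Commute s g := fun g =>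
    Subtype.ext (LinearEquiv.ext fun x => (map_neg g.1 x).symm)
  have hdet : LinearEquiv.det s.1 = -1 := Units.ext (by
    rw [LinearEquiv.coe_det, show (s.1 : V →ₗ[F] V) = (-1 : F) • LinearMap.id from
      (neg_one_smul F LinearMap.id).symm, LinearMap.det_smul, hodd.neg_one_pow]
    simp)
  refine not_dvd_index_commutator _ hl hl2 hgen.closure_eq_top s (by rw [hs]; exact one_mem _) ?_
  rintro _ (⟨v, hv, rfl⟩ | hg)
  · rw [inv_eq_of_mul_eq_one_left hs, ← (hcomm _).eq]
    exact Or.inr (mul_reflIsom_mem_coprimePart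
      ((Nat.coprime_primes Nat.prime_two hl).mpr hl2.symm) hs hdet hv (hcomm _))
  · exact Or.inl (mem_coprimePart_of_pow_char_eq_one hp
      ((Nat.coprime_primes hp hl).mpr hlp.symm) hg)

theorem not_dvd_index_commutator_rotations_of_orthogonal (hp : p.Prime)
    (hl : l.Prime) (hl2 : l ≠ 2) (hlp : l ≠ p) (hgen : GeneratedBy p Q)
    (horth : ∀ u v, Q u ≠ 0 → Q v ≠ 0 → ∃ w, Q w ≠ 0 ∧ polar Q u w = 0 ∧ polar Q v w = 0) :
    ¬ l ∣ ⁅rotations Q, rotations Q⁆.index := by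
  have hpl : p.Coprime l := (Nat.coprime_primes hp hl).mpr hlp.symm
  have h2l : Nat.Coprime 2 l := (Nat.coprime_primes Nat.prime_two hl).mpr hl2.symm
  have hmul : ∀ {u w : V} (hu : Q u ≠ 0) (hw : Q w ≠ 0), polar Q u w = 0 →
      reflIsom hu * reflIsom hw ∈ coprimePart (rotations Q) l := fun hu hw h =>
    mul_reflIsom_mem_coprimePart h2l (reflIsom_mul_self hu) (det_reflIsom hu) hw
      (reflIsom_commute hu hw h)
  by_cases hex : ∃ v, Q v ≠ 0
  · obtain ⟨v, hv⟩ := hex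
    refine not_dvd_index_commutator _ hl hl2 hgen.closure_eq_top (reflIsom hv)
      (by rw [reflIsom_mul_self]; exact one_mem _) ?_
    rintro _ (⟨u, hu, rfl⟩ | hg)
    · -- Insert the square of the reflection in a vector orthogonal to `u` and `v`.
      obtain ⟨w, hw, huw, hvw⟩ := horth u v hu hv
      have hprod : reflIsom hu * (reflIsom hv)⁻¹ =
          reflIsom hu * reflIsom hw * (reflIsom hw * reflIsom hv) := by
        rw [inv_eq_of_mul_eq_one_left (reflIsom_mul_self hv), mul_assoc,
          ← mul_assoc (reflIsom hw), reflIsom_mul_self, one_mul]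
      exact Or.inr (hprod ▸ mul_mem (hmul hu hw huw) (hmul hw hv (by rwa [polar_comm])))
    · exact Or.inl (mem_coprimePart_of_pow_char_eq_one hp hpl hg)
  · refine not_dvd_index_commutator _ hl hl2 hgen.closure_eq_top 1
      (by rw [one_mul]; exact one_mem _) ?_
    rintro _ (⟨v, hv, -⟩ | hg)
    · exact (hex ⟨v, hv⟩).elim
    · exact Or.inl (mem_coprimePart_of_pow_char_eq_one hp hpl hg)

theorem not_dvd_index_commutator_rotations (hp : p.Prime) (hl : l.Prime)
    (hl2 : l ≠ 2) (hlp : l ≠ p) (hQ : Regular Q) (hgen : GeneratedBy p Q)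
    (hdim : Module.finrank F V ≠ 2 ∨ p = 2) : ¬ l ∣ ⁅rotations Q, rotations Q⁆.index := by
  rcases eq_or_ne p 2 with rfl | hp2
  · exact not_dvd_index_commutator_rotations_of_char_two hl hl2 hgen
  rcases Nat.even_or_odd (Module.finrank F V) with heven | hodd
  · refine not_dvd_index_commutator_rotations_of_orthogonal hp hl hl2 hlp hgen
      fun u v hu _ => ?_
    have hpos : 0 < Module.finrank F V :=
      Module.finrank_pos_iff_exists_ne_zero.mpr ⟨u, fun h => hu (h ▸ QuadraticMap.map_zero Q)⟩
    exact exists_orthogonal_nonsingular hQ (Ring.two_ne_zero (by rwa [ringChar.eq F p]))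
      (by grind) hu v
  · exact not_dvd_index_commutator_rotations_of_odd hp hl hl2 hlp hgen hodd

end Rotations

section Matrices

open EssDim

variable {F : Type v} [Field F] {ι : Type} [Fintype ι] [DecidableEq ι]

/-- The identification of invertible matrices with linear automorphisms. -/
def glEquiv : GL ι F ≃* ((ι → F) ≃ₗ[F] (ι → F)) :=
  Matrix.GeneralLinearGroup.toLin.trans (LinearMap.GeneralLinearGroup.generalLinearEquiv F (ι → F))

lemma det_glEquiv (M : GL ι F) :
    LinearEquiv.det (glEquiv M) = Matrix.GeneralLinearGroup.det M := by
  refine Units.ext ?_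
  rw [LinearEquiv.coe_det, Matrix.GeneralLinearGroup.val_det_apply]
  exact LinearMap.det_toLin' M.val

variable {Q : QuadraticForm F (ι → F)}

lemma glEquiv_mem_isom {M : GL ι F} : glEquiv M ∈ isom Q ↔ M ∈ O Q := Iff.rfl

lemma map_glEquiv_O : (O Q).map glEquiv.toMonoidHom = isom Q := by
  ext g
  obtain ⟨M, rfl⟩ := glEquiv.surjective g
  exact (Subgroup.mem_map_iff_mem glEquiv.injective).trans glEquiv_mem_isom.symm

/-- The identification of the orthogonal group of matrices with the isometry group. -/
def oEquiv (Q : QuadraticForm F (ι → F)) : O Q ≃* isom Q :=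
  (glEquiv.subgroupMap (O Q)).trans (MulEquiv.subgroupCongr map_glEquiv_O)

lemma card_O (Q : QuadraticForm F (ι → F)) : Nat.card (O Q) = Nat.card (isom Q) :=
  Nat.card_congr (oEquiv Q).toEquiv

lemma SO_le_O : SO Q ≤ O Q := inf_le_left

lemma Omega_le_O : Omega Q ≤ O Q :=
  (Subgroup.commutator_mono SO_le_O SO_le_O).trans (Subgroup.commutator_le_self _)

lemma map_glEquiv_SO :
    (SO Q).map glEquiv.toMonoidHom = (rotations Q).map (isom Q).subtype := by
  ext g
  obtain ⟨M, rfl⟩ := glEquiv.surjective g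
  rw [Subgroup.mem_map_equiv, MulEquiv.symm_apply_apply, SO, Subgroup.mem_inf, MonoidHom.mem_ker,
    ← det_glEquiv, ← glEquiv_mem_isom]
  exact ⟨fun ⟨hM, hdet⟩ => ⟨⟨_, hM⟩, hdet, rfl⟩, by rintro ⟨g, hdet, hg⟩; exact hg ▸ ⟨g.2, hdet⟩⟩

lemma card_Omega : Nat.card (Omega Q) = Nat.card ↥⁅rotations Q, rotations Q⁆ := by
  rw [← Subgroup.card_map_of_injective (isom Q).subtype_injective, Subgroup.map_commutator,
    ← map_glEquiv_SO, ← Subgroup.map_commutator]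
  exact (Subgroup.card_map_of_injective glEquiv.injective).symm

variable [Finite F] {l : ℕ}

theorem factorization_card_Omega (h : ¬ l ∣ ⁅rotations Q, rotations Q⁆.index) :
    (Nat.card (Omega Q)).factorization l = (Nat.card (O Q)).factorization l := by
  rw [card_Omega, card_O, ← Subgroup.card_mul_index ⁅rotations Q, rotations Q⁆,
    Nat.factorization_mul Nat.card_pos.ne' Subgroup.index_ne_zero_of_finite, Finsupp.add_apply,
    Nat.factorization_eq_zero_of_not_dvd h, add_zero]

variable {k : Type u} [Field k]

lemma not_dvd_card_signs_subgroupOf (hl : l.Prime) (hl2 : l ≠ 2) (H : Subgroup (GL ι F)) :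
    ¬ l ∣ Nat.card ((signs F ι).subgroupOf H) := by
  refine not_dvd_card_of_mul_self hl hl2 ?_
  rintro ⟨⟨M, hM⟩, hs⟩
  refine Subtype.ext (Subtype.ext ?_)
  change M * M = 1
  rcases (hs : M = 1 ∨ M = -1) with rfl | rfl
  · exact mul_one 1
  · rw [neg_mul_neg, one_mul]

lemma essDimAt_POmega_eq_Omega (hl : l.Prime) (hl2 : l ≠ 2) :
    essDimAt k (POmega Q) l = essDimAt k (Omega Q) l := by
  have hsigns := not_dvd_card_signs_subgroupOf hl hl2 (Omega Q)
  refine (essDimAt_eq_of_hom (QuotientGroup.mk' ((signs F ι).subgroupOf (Omega Q))) hl ?_ ?_).symm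
  · rwa [QuotientGroup.ker_mk']
  · rw [Subgroup.card_eq_card_quotient_mul_card_subgroup ((signs F ι).subgroupOf (Omega Q)),
      Nat.factorization_mul Nat.card_pos.ne' Nat.card_pos.ne', Finsupp.add_apply,
      Nat.factorization_eq_zero_of_not_dvd hsigns, add_zero]

theorem essDimAt_POmega {p : ℕ} (hp : p.Prime) [CharP F p] (hl : l.Prime) (hl2 : l ≠ 2)
    (hlp : l ≠ p) (hQ : Regular Q) (hgen : GeneratedBy p Q) (hdim : Fintype.card ι ≠ 2 ∨ p = 2) :
    essDimAt k (POmega Q) l = essDimAt k (O Q) l := by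
  have hindex : ¬ l ∣ ⁅rotations Q, rotations Q⁆.index :=
    not_dvd_index_commutator_rotations hp hl hl2 hlp hQ hgen
      (by rwa [Module.finrank_fintype_fun_eq_card])
  rw [essDimAt_POmega_eq_Omega hl hl2]
  exact essDimAt_eq_of_injective_of_factorization_eq (Subgroup.inclusion_injective Omega_le_O) hl
    (factorization_card_Omega hindex)

end Matrices

section Embeddings

variable {F : Type v} [Field F] {ι : Type} [Fintype ι] [DecidableEq ι]

/-- The block diagonal embedding `M ↦ diag(1, M)`. -/
def blockHom (κ : Type) [Fintype κ] [DecidableEq κ] : GL ι F →* GL (κ ⊕ ι) F :=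
  MonoidHom.toHomUnits
    { toFun := fun M => Matrix.fromBlocks 1 0 0 (M : Matrix ι ι F)
      map_one' := by rw [Units.val_one, Matrix.fromBlocks_one]
      map_mul' := fun M N => by simp [Matrix.fromBlocks_multiply] }

lemma coe_blockHom (κ : Type) [Fintype κ] [DecidableEq κ] (M : GL ι F) :
    (blockHom κ M : Matrix (κ ⊕ ι) (κ ⊕ ι) F) = Matrix.fromBlocks 1 0 0 M.1 := rfl

lemma blockHom_injective (κ : Type) [Fintype κ] [DecidableEq κ] :
    Function.Injective (blockHom (F := F) (ι := ι) κ) := fun M N h => by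
  have hblocks := congrArg Units.val h
  rw [coe_blockHom, coe_blockHom, Matrix.fromBlocks_inj] at hblocks
  exact Units.ext hblocks.2.2.2

lemma exists_injective_GL {n : ℕ} (hn : Fintype.card ι ≤ n) :
    ∃ f : GL ι F →* GL (Fin n) F, Function.Injective f := by
  have e : Fin (n - Fintype.card ι) ⊕ ι ≃ Fin n := Fintype.equivFinOfCardEq (by simp [hn])
  let g : GL (Fin (n - Fintype.card ι) ⊕ ι) F ≃* GL (Fin n) F :=
    Units.mapEquiv (Matrix.reindexAlgEquiv F F e).toMulEquiv
  exact ⟨g.toMonoidHom.comp (blockHom _), g.injective.comp (blockHom_injective _)⟩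

/-- The homomorphism `M ↦ diag(M, M⁻ᵀ)`, whose image preserves the split form. -/
def diagHom : GL ι F →* GL (ι ⊕ ι) F :=
  MonoidHom.toHomUnits
    { toFun := fun M => Matrix.fromBlocks M.1 0 0 (M⁻¹).1.transpose
      map_one' := by simp
      map_mul' := fun M N => by simp [Matrix.fromBlocks_multiply, Matrix.transpose_mul] }

lemma coe_diagHom (M : GL ι F) :
    (diagHom M : Matrix (ι ⊕ ι) (ι ⊕ ι) F) = Matrix.fromBlocks M.1 0 0 (M⁻¹).1.transpose := rfl

lemma diagHom_mem_O {m : ℕ} (M : GL (Fin m) F) : diagHom M ∈ O (plusForm F m) := fun x => by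
  let y : Fin m → F := fun i => x (.inl i)
  let z : Fin m → F := fun i => x (.inr i)
  have hpairing : (M.1.mulVec y) ⬝ᵥ ((M⁻¹).1.transpose.mulVec z) = y ⬝ᵥ z := by
    rw [Matrix.mulVec_transpose, dotProduct_comm, ← Matrix.dotProduct_mulVec,
      Matrix.mulVec_mulVec, ← Units.val_mul, inv_mul_cancel, Units.val_one, Matrix.one_mulVec,
      dotProduct_comm]
  rw [coe_diagHom, Matrix.fromBlocks_mulVec, Matrix.zero_mulVec, Matrix.zero_mulVec, add_zero,
    zero_add, plusForm_apply, plusForm_apply]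
  exact hpairing

/-- The embedding `M ↦ diag(M, M⁻ᵀ)` of the general linear group into the split orthogonal
group. -/
def hyperbolicHom (F : Type v) [Field F] (m : ℕ) : GL (Fin m) F →* O (plusForm F m) :=
  diagHom.codRestrict _ diagHom_mem_O

lemma hyperbolicHom_injective (m : ℕ) : Function.Injective (hyperbolicHom F m) := fun M N h => by
  have hblocks : (diagHom M).1 = (diagHom N).1 := congrArg (fun A => A.1.1) h
  rw [coe_diagHom, coe_diagHom, Matrix.fromBlocks_inj] at hblocks
  exact Units.ext hblocks.1

variable {a : ℕ} (N : QuadraticForm F (Fin a → F)) (m : ℕ)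

lemma blockHom_mem_O {m : ℕ} {M : GL (Fin m ⊕ Fin m) F} (hM : M ∈ O (plusForm F m)) :
    blockHom (Fin a) M ∈ O (addPlusForm N m) := fun x => by
  rw [coe_blockHom, Matrix.fromBlocks_mulVec, Matrix.zero_mulVec, Matrix.zero_mulVec, add_zero,
    zero_add, Matrix.one_mulVec]
  exact congrArg (N (fun i => x (.inl i)) + ·) (hM fun i => x (.inr i))

/-- Extension of the isometries of the split form by the identity on the summand `N`. -/
def plusHom : O (plusForm F m) →* O (addPlusForm N m) :=
  ((blockHom (Fin a)).comp (O (plusForm F m)).subtype).codRestrict _ fun M => blockHom_mem_O N M.2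

lemma plusHom_injective : Function.Injective (plusHom N m) := fun _ _ h =>
  Subtype.ext (blockHom_injective _ (congrArg Subtype.val h))

/-- Extension of isometries by the identity on a hyperbolic plane. -/
def succHom : isom (addPlusForm N m) →* isom (addPlusForm N (m + 1)) :=
  (isomCongr (addPlusFormSucc N m)).symm.toMonoidHom.comp
    ((extHyp.comp (isom (addPlusForm N m)).subtype).codRestrict _ fun g => extHyp_mem_isom g.2)

lemma succHom_injective : Function.Injective (succHom N m) := fun _ _ h =>
  Subtype.ext (extHyp_injective
    (congrArg Subtype.val ((isomCongr (addPlusFormSucc N m)).symm.injective h)))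

end Embeddings

section Comparison

open EssDim

variable {k : Type u} [Field k] {l : ℕ} {F : Type v} [Field F] [Finite F] {ι : Type} [Fintype ι]
  [DecidableEq ι]

lemma essDimAt_O_eq_GL (Q : QuadraticForm F (ι → F)) (hl : l.Prime) {n : ℕ}
    (hn : Fintype.card ι ≤ n)
    (h : (Nat.card (isom Q)).factorization l = (Nat.card (GL (Fin n) F)).factorization l) :
    essDimAt k (O Q) l = essDimAt k (GL (Fin n) F) l := by
  obtain ⟨f, hf⟩ := exists_injective_GL (F := F) hn
  exact essDimAt_eq_of_injective_of_factorization_eq (f := f.comp (O Q).subtype)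
    (hf.comp (O Q).subtype_injective) hl (by rw [card_O, h])

lemma essDimAt_GL_eq_GL (hl : l.Prime) {m n : ℕ} (hmn : m ≤ n)
    (h : (Nat.card (GL (Fin m) F)).factorization l = (Nat.card (GL (Fin n) F)).factorization l) :
    essDimAt k (GL (Fin m) F) l = essDimAt k (GL (Fin n) F) l := by
  obtain ⟨f, hf⟩ := exists_injective_GL (F := F) ((Fintype.card_fin m).trans_le hmn)
  exact essDimAt_eq_of_injective_of_factorization_eq hf hl h

lemma essDimAt_O_plusForm_eq_GL (hl : l.Prime) {m : ℕ}
    (h : (Nat.card (isom (plusForm F m))).factorization l =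
      (Nat.card (GL (Fin m) F)).factorization l) :
    essDimAt k (O (plusForm F m)) l = essDimAt k (GL (Fin m) F) l :=
  (essDimAt_eq_of_injective_of_factorization_eq (hyperbolicHom_injective m) hl
    (by rw [card_O, h])).symm

lemma essDimAt_O_addPlusForm_eq_plusForm {a : ℕ} (N : QuadraticForm F (Fin a → F)) (hl : l.Prime)
    {m : ℕ} (h : (Nat.card (isom (addPlusForm N m))).factorization l =
      (Nat.card (isom (plusForm F m))).factorization l) :
    essDimAt k (O (addPlusForm N m)) l = essDimAt k (O (plusForm F m)) l :=
  (essDimAt_eq_of_injective_of_factorization_eq (plusHom_injective N m) hl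
    (by rw [card_O, card_O, h])).symm

lemma essDimAt_O_addPlusForm_succ {a : ℕ} (N : QuadraticForm F (Fin a → F)) (hl : l.Prime) {m : ℕ}
    (h : (Nat.card (isom (addPlusForm N (m + 1)))).factorization l =
      (Nat.card (isom (addPlusForm N m))).factorization l) :
    essDimAt k (O (addPlusForm N (m + 1))) l = essDimAt k (O (addPlusForm N m)) l := by
  rw [essDimAt_congr (oEquiv _) l, essDimAt_congr (oEquiv (addPlusForm N m)) l]
  exact (essDimAt_eq_of_injective_of_factorization_eq (succHom_injective N m) hl h.symm).symm

lemma essDimAt_O_plusForm_succ (hl : l.Prime) {m : ℕ}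
    (h : (Nat.card (isom (plusForm F (m + 1)))).factorization l =
      (Nat.card (isom (plusForm F m))).factorization l) :
    essDimAt k (O (plusForm F (m + 1))) l = essDimAt k (O (plusForm F m)) l := by
  have hplus : ∀ n, essDimAt k (O (plusForm F n)) l =
      essDimAt k (O (addPlusForm (0 : QuadraticForm F (Fin 0 → F)) n)) l := fun n =>
    essDimAt_congr
      (((oEquiv _).trans (isomCongr (plusFormEquiv n))).trans (oEquiv _).symm) l
  rw [hplus, hplus]
  refine essDimAt_O_addPlusForm_succ _ hl ?_
  rwa [← Nat.card_congr (isomCongr (plusFormEquiv (F := F) m)).toEquiv,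
    ← Nat.card_congr (isomCongr (plusFormEquiv (F := F) (m + 1))).toEquiv]

end Comparison

section Divisibility

variable {q l d : ℕ}

lemma orderOf_eq_of_isLeast (hq : 0 < q) (hd : IsLeast {e : ℕ | 0 < e ∧ l ∣ q ^ e - 1} d) :
    orderOf (q : ZMod l) = d := by
  have hdvd : ∀ e, l ∣ q ^ e - 1 ↔ (q : ZMod l) ^ e = 1 := fun e => by
    rw [← ZMod.natCast_eq_zero_iff, Nat.cast_sub (Nat.one_le_pow _ _ hq), sub_eq_zero,
      Nat.cast_pow, Nat.cast_one]
  rw [orderOf_eq_iff hd.1.1]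
  exact ⟨(hdvd d).mp hd.1.2, fun e hed he h => hed.not_ge (hd.2 ⟨he, (hdvd e).mpr h⟩)⟩

variable (hq : 0 < q) (hd : IsLeast {e : ℕ | 0 < e ∧ l ∣ q ^ e - 1} d)
include hq hd

lemma dvd_of_factorization_pow_sub_one_ne_zero {j : ℕ} (h : (q ^ j - 1).factorization l ≠ 0) :
    d ∣ j := by
  have hdvd := Nat.dvd_of_factorization_pos h
  rw [← ZMod.natCast_eq_zero_iff, Nat.cast_sub (Nat.one_le_pow _ _ hq), sub_eq_zero,
    Nat.cast_pow, Nat.cast_one] at hdvd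
  exact orderOf_eq_of_isLeast hq hd ▸ orderOf_dvd_of_pow_eq_one hdvd

lemma factorization_pow_sub_one_eq_zero_of_odd_div {m : ℕ} (h : Odd (2 * m / d)) :
    (q ^ m - 1).factorization l = 0 := by
  by_contra hne
  have hdvd := dvd_of_factorization_pow_sub_one_ne_zero hq hd hne
  rw [Nat.mul_div_assoc 2 hdvd] at h
  exact Nat.not_odd_iff_even.mpr (even_two_mul _) h

lemma factorization_pow_odd_sub_one (hde : Even d) (j : ℕ) :
    (q ^ (2 * j + 1) - 1).factorization l = 0 := by
  by_contra hne
  have := hde.two_dvd.trans (dvd_of_factorization_pow_sub_one_ne_zero hq hd hne)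
  omega

lemma factorization_pow_sub_one_of_pow_succ_sub_one_ne_zero (hde : Even d) {m : ℕ}
    (h : (q ^ (m + 1) - 1).factorization l ≠ 0) : (q ^ m - 1).factorization l = 0 := by
  by_contra hne
  have hd1 : d ∣ 1 := (Nat.dvd_add_right (dvd_of_factorization_pow_sub_one_ne_zero hq hd hne)).mp
    (dvd_of_factorization_pow_sub_one_ne_zero hq hd h)
  exact Nat.not_even_one (Nat.dvd_one.mp hd1 ▸ hde)

variable (hl : l.Prime) (hl2 : l ≠ 2)
include hl hl2

lemma dvd_of_factorization_pow_add_one_ne_zero {j : ℕ} (h : (q ^ j + 1).factorization l ≠ 0) :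
    d ∣ 2 * j ∧ ¬ d ∣ j := by
  have hpow := Nat.dvd_of_factorization_pos h
  have : Fact (2 < l) := ⟨lt_of_le_of_ne hl.two_le hl2.symm⟩
  rw [← ZMod.natCast_eq_zero_iff, Nat.cast_add, Nat.cast_pow, Nat.cast_one,
    add_eq_zero_iff_eq_neg] at hpow
  rw [← orderOf_eq_of_isLeast hq hd]
  refine ⟨orderOf_dvd_of_pow_eq_one ?_, fun hdvd => ?_⟩
  · rw [mul_comm, pow_mul, hpow, neg_one_sq]
  · rw [orderOf_dvd_iff_pow_eq_one, hpow] at hdvd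
    exact ZMod.neg_one_ne_one hdvd

lemma factorization_pow_add_one_of_odd (hdo : Odd d) (j : ℕ) :
    (q ^ j + 1).factorization l = 0 := by
  by_contra hne
  obtain ⟨h2j, hj⟩ := dvd_of_factorization_pow_add_one_ne_zero hq hd hl hl2 hne
  exact hj ((Nat.coprime_two_right.mpr hdo).dvd_of_dvd_mul_left h2j)

lemma factorization_pow_add_one_eq_zero_of_even_div {m : ℕ} (h : Even (2 * m / d)) :
    (q ^ m + 1).factorization l = 0 := by
  by_contra hne
  obtain ⟨h2m, hm⟩ := dvd_of_factorization_pow_add_one_ne_zero hq hd hl hl2 hne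
  obtain ⟨t, ht⟩ := h.two_dvd
  refine hm ⟨t, ?_⟩
  have := Nat.mul_div_cancel' h2m
  rw [ht] at this
  linarith

lemma factorization_pow_add_one_of_pow_succ_add_one_ne_zero {m : ℕ}
    (h : (q ^ (m + 1) + 1).factorization l ≠ 0) : (q ^ m + 1).factorization l = 0 := by
  by_contra hne
  obtain ⟨h2s, hs⟩ := dvd_of_factorization_pow_add_one_ne_zero hq hd hl hl2 h
  obtain ⟨h2m, hm⟩ := dvd_of_factorization_pow_add_one_ne_zero hq hd hl hl2 hne
  rw [Nat.mul_add_one] at h2s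
  rcases (Nat.dvd_prime Nat.prime_two).mp ((Nat.dvd_add_right h2m).mp h2s) with rfl | rfl <;> omega

end Divisibility

section OddOrder

open EssDim

variable {k : Type u} [Field k] {F : Type v} [Field F] [Finite F] {l d : ℕ} (hl : l.Prime)
  (hl2 : l ≠ 2) (hq : ¬ l ∣ Nat.card F)
  (hd : IsLeast {e : ℕ | 0 < e ∧ l ∣ Nat.card F ^ e - 1} d) (hdo : Odd d)
include hl hl2 hq hd hdo

lemma factorization_GL_of_odd (m : ℕ) : (Nat.card (GL (Fin m) F)).factorization l =
    ∑ j ∈ Finset.range m, (Nat.card F ^ (2 * (j + 1)) - 1).factorization l := by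
  rw [factorization_GL hl hq]
  refine Finset.sum_congr rfl fun j _ => ?_
  rw [factorization_pow_two_mul_sub_one Finite.one_lt_card j.succ_pos,
    factorization_pow_add_one_of_odd Nat.card_pos hd hl hl2 hdo, add_zero]

lemma factorization_isom_plusForm_of_odd (m : ℕ) :
    (Nat.card (isom (plusForm F m))).factorization l =
      (Nat.card (GL (Fin m) F)).factorization l := by
  rw [factorization_GL_of_odd hl hl2 hq hd hdo, ← factorization_isom_plusForm_add hl hq hl2,
    factorization_pow_add_one_of_odd Nat.card_pos hd hl hl2 hdo, add_zero]

lemma factorization_isom_addPlusForm_two_of_odd {N : QuadraticForm F (Fin 2 → F)}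
    (hN : N.Anisotropic) (m : ℕ) : (Nat.card (isom (addPlusForm N m))).factorization l =
      (Nat.card (GL (Fin m) F)).factorization l := by
  have hsucc := factorization_GL_of_odd hl hl2 hq hd hdo (m + 1)
  rw [← factorization_isom_addPlusForm_two_add hl hq hl2 hN, factorization_GL hl hq,
    Finset.sum_range_succ, ← factorization_GL hl hq] at hsucc
  exact (Nat.add_right_cancel hsucc).symm

theorem essDimAt_O_plusForm_of_odd (m : ℕ) :
    essDimAt k (O (plusForm F m)) l = essDimAt k (GL (Fin m) F) l :=
  essDimAt_O_plusForm_eq_GL hl (factorization_isom_plusForm_of_odd hl hl2 hq hd hdo m)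

theorem essDimAt_O_oddForm_of_odd {c : F} (hc : c ≠ 0) (m : ℕ) :
    essDimAt k (O (oddForm c m)) l = essDimAt k (GL (Fin m) F) l := by
  refine .trans (essDimAt_O_addPlusForm_eq_plusForm _ hl ?_)
    (essDimAt_O_plusForm_of_odd hl hl2 hq hd hdo m)
  exact (factorization_isom_oddForm hl hq hl2 hc m).trans
    ((factorization_isom_plusForm_of_odd hl hl2 hq hd hdo m).trans
      (factorization_GL_of_odd hl hl2 hq hd hdo m)).symm

theorem essDimAt_O_addPlusForm_two_of_odd {N : QuadraticForm F (Fin 2 → F)} (hN : N.Anisotropic)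
    (m : ℕ) : essDimAt k (O (addPlusForm N m)) l = essDimAt k (GL (Fin m) F) l := by
  refine .trans (essDimAt_O_addPlusForm_eq_plusForm N hl ?_)
    (essDimAt_O_plusForm_of_odd hl hl2 hq hd hdo m)
  rw [factorization_isom_addPlusForm_two_of_odd hl hl2 hq hd hdo hN,
    factorization_isom_plusForm_of_odd hl hl2 hq hd hdo]

end OddOrder

lemma sum_range_two_mul {a : ℕ → ℕ} (ha : ∀ j, a (2 * j + 1) = 0) (m : ℕ) :
    ∑ j ∈ Finset.range (2 * m), a (j + 1) = ∑ j ∈ Finset.range m, a (2 * (j + 1)) := by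
  induction m with
  | zero => rfl
  | succ m ih =>
    rw [Nat.mul_add_one, Finset.sum_range_succ, Finset.sum_range_succ, Finset.sum_range_succ, ih,
      ha, add_zero, Nat.mul_add_one]

section EvenOrder

open EssDim

variable {k : Type u} [Field k] {F : Type v} [Field F] [Finite F] {l d : ℕ} (hl : l.Prime)
  (hq : ¬ l ∣ Nat.card F) (hd : IsLeast {e : ℕ | 0 < e ∧ l ∣ Nat.card F ^ e - 1} d) (hde : Even d)
include hl hq hd hde

lemma factorization_GL_two_mul (m : ℕ) : (Nat.card (GL (Fin (2 * m)) F)).factorization l =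
    ∑ j ∈ Finset.range m, (Nat.card F ^ (2 * (j + 1)) - 1).factorization l :=
  (factorization_GL hl hq _).trans
    (sum_range_two_mul (a := fun j => (Nat.card F ^ j - 1).factorization l)
      (factorization_pow_odd_sub_one Nat.card_pos hd hde) m)

lemma factorization_GL_two_mul_add_one (m : ℕ) :
    (Nat.card (GL (Fin (2 * m + 1)) F)).factorization l =
      (Nat.card (GL (Fin (2 * m)) F)).factorization l := by
  rw [factorization_GL hl hq, factorization_GL hl hq, Finset.sum_range_succ,
    factorization_pow_odd_sub_one Nat.card_pos hd hde, add_zero]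

lemma factorization_GL_two_mul_succ (m : ℕ) :
    (Nat.card (GL (Fin (2 * (m + 1))) F)).factorization l =
      (Nat.card (GL (Fin (2 * m)) F)).factorization l +
        ((Nat.card F ^ (m + 1) - 1).factorization l +
          (Nat.card F ^ (m + 1) + 1).factorization l) := by
  rw [factorization_GL_two_mul hl hq hd hde, factorization_GL_two_mul hl hq hd hde,
    Finset.sum_range_succ, factorization_pow_two_mul_sub_one Finite.one_lt_card m.succ_pos]

lemma essDimAt_GL_two_mul_succ {m : ℕ} (hsub : (Nat.card F ^ (m + 1) - 1).factorization l = 0)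
    (hadd : (Nat.card F ^ (m + 1) + 1).factorization l = 0) :
    essDimAt k (GL (Fin (2 * (m + 1))) F) l = essDimAt k (GL (Fin (2 * m)) F) l := by
  refine (essDimAt_GL_eq_GL hl (by omega) ?_).symm
  rw [factorization_GL_two_mul_succ hl hq hd hde, hsub, hadd, add_zero, add_zero]

variable (hl2 : l ≠ 2)
include hl2

lemma factorization_isom_plusForm_add_eq_GL (m : ℕ) :
    (Nat.card (isom (plusForm F m))).factorization l + (Nat.card F ^ m + 1).factorization l =
      (Nat.card (GL (Fin (2 * m)) F)).factorization l :=
  (factorization_isom_plusForm_add hl hq hl2 m).trans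
    (factorization_GL_two_mul hl hq hd hde m).symm

lemma factorization_isom_addPlusForm_two_add_eq_GL {N : QuadraticForm F (Fin 2 → F)}
    (hN : N.Anisotropic) (m : ℕ) :
    (Nat.card (isom (addPlusForm N m))).factorization l +
        (Nat.card F ^ (m + 1) - 1).factorization l =
      (Nat.card (GL (Fin (2 * (m + 1))) F)).factorization l :=
  (factorization_isom_addPlusForm_two_add hl hq hl2 hN m).trans
    (factorization_GL_two_mul hl hq hd hde (m + 1)).symm

theorem essDimAt_O_oddForm_of_even {c : F} (hc : c ≠ 0) (m : ℕ) :
    essDimAt k (O (oddForm c m)) l = essDimAt k (GL (Fin (2 * m)) F) l := by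
  have hGL := factorization_GL_two_mul_add_one hl hq hd hde m
  rw [essDimAt_GL_eq_GL hl (Nat.le_succ _) hGL.symm]
  refine essDimAt_O_eq_GL _ hl (by simp; omega) ?_
  rw [factorization_isom_oddForm hl hq hl2 hc, hGL, factorization_GL_two_mul hl hq hd hde]

lemma essDimAt_O_plusForm_of_factorization {m : ℕ}
    (h : (Nat.card F ^ m + 1).factorization l = 0) :
    essDimAt k (O (plusForm F m)) l = essDimAt k (GL (Fin (2 * m)) F) l := by
  refine essDimAt_O_eq_GL _ hl (by simp; omega) ?_
  rw [← factorization_isom_plusForm_add_eq_GL hl hq hd hde hl2, h, add_zero]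

lemma essDimAt_O_addPlusForm_two_of_factorization {N : QuadraticForm F (Fin 2 → F)}
    (hN : N.Anisotropic) {m : ℕ} (h : (Nat.card F ^ (m + 1) - 1).factorization l = 0) :
    essDimAt k (O (addPlusForm N m)) l = essDimAt k (GL (Fin (2 * (m + 1))) F) l := by
  refine essDimAt_O_eq_GL _ hl (by simp; omega) ?_
  rw [← factorization_isom_addPlusForm_two_add_eq_GL hl hq hd hde hl2 hN, h, add_zero]

theorem essDimAt_O_plusForm_of_even_of_even {m : ℕ} (h : Even (2 * m / d)) :
    essDimAt k (O (plusForm F m)) l = essDimAt k (GL (Fin (2 * m)) F) l :=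
  essDimAt_O_plusForm_of_factorization hl hq hd hde hl2
    (factorization_pow_add_one_eq_zero_of_even_div Nat.card_pos hd hl hl2 h)

theorem essDimAt_O_plusForm_of_even_of_odd {m : ℕ} (h : Odd (2 * m / d)) :
    essDimAt k (O (plusForm F m)) l = essDimAt k (GL (Fin (2 * m - 2)) F) l := by
  obtain ⟨n, rfl⟩ : ∃ n, m = n + 1 := Nat.exists_eq_succ_of_ne_zero (by rintro rfl; simp at h)
  have hsub := factorization_pow_sub_one_eq_zero_of_odd_div Nat.card_pos hd h
  by_cases hadd : (Nat.card F ^ (n + 1) + 1).factorization l = 0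
  · exact (essDimAt_O_plusForm_of_factorization hl hq hd hde hl2 hadd).trans
      (essDimAt_GL_two_mul_succ hl hq hd hde hsub hadd)
  have hadd' := factorization_pow_add_one_of_pow_succ_add_one_ne_zero Nat.card_pos hd hl hl2 hadd
  have hsplit : (Nat.card (isom (plusForm F (n + 1)))).factorization l =
      (Nat.card (isom (plusForm F n))).factorization l := by
    have hn := factorization_isom_plusForm_add_eq_GL hl hq hd hde hl2 n
    have hn1 := factorization_isom_plusForm_add_eq_GL hl hq hd hde hl2 (n + 1)
    have hGL := factorization_GL_two_mul_succ hl hq hd hde n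
    omega
  exact (essDimAt_O_plusForm_succ hl hsplit).trans
    (essDimAt_O_plusForm_of_factorization hl hq hd hde hl2 hadd')

theorem essDimAt_O_addPlusForm_two_of_even_of_odd {N : QuadraticForm F (Fin 2 → F)}
    (hN : N.Anisotropic) {m : ℕ} (h : Odd (2 * (m + 1) / d)) :
    essDimAt k (O (addPlusForm N m)) l = essDimAt k (GL (Fin (2 * (m + 1))) F) l :=
  essDimAt_O_addPlusForm_two_of_factorization hl hq hd hde hl2 hN
    (factorization_pow_sub_one_eq_zero_of_odd_div Nat.card_pos hd h)

theorem essDimAt_O_addPlusForm_two_of_even_of_even {N : QuadraticForm F (Fin 2 → F)}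
    (hN : N.Anisotropic) {m : ℕ} (h : Even (2 * (m + 1) / d)) :
    essDimAt k (O (addPlusForm N m)) l = essDimAt k (GL (Fin (2 * m)) F) l := by
  have hadd := factorization_pow_add_one_eq_zero_of_even_div Nat.card_pos hd hl hl2 h
  by_cases hsub : (Nat.card F ^ (m + 1) - 1).factorization l = 0
  · exact (essDimAt_O_addPlusForm_two_of_factorization hl hq hd hde hl2 hN hsub).trans
      (essDimAt_GL_two_mul_succ hl hq hd hde hsub hadd)
  have hsub' := factorization_pow_sub_one_of_pow_succ_sub_one_ne_zero Nat.card_pos hd hde hsub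
  obtain ⟨n, rfl⟩ : ∃ n, m = n + 1 := Nat.exists_eq_succ_of_ne_zero (by
    rintro rfl
    exact hsub (factorization_pow_odd_sub_one Nat.card_pos hd hde 0))
  have hsplit : (Nat.card (isom (addPlusForm N (n + 1)))).factorization l =
      (Nat.card (isom (addPlusForm N n))).factorization l := by
    have hn := factorization_isom_addPlusForm_two_add_eq_GL hl hq hd hde hl2 hN n
    have hn1 := factorization_isom_addPlusForm_two_add_eq_GL hl hq hd hde hl2 hN (n + 1)
    have hGL := factorization_GL_two_mul_succ hl hq hd hde (n + 1)
    omega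
  exact (essDimAt_O_addPlusForm_succ N hl hsplit).trans
    (essDimAt_O_addPlusForm_two_of_factorization hl hq hd hde hl2 hN hsub')

end EvenOrder

section POmega

open EssDim

variable {k : Type u} [Field k] {F : Type v} [Field F] [Finite F] {p l : ℕ} [CharP F p]
  (hp : p.Prime) (hl : l.Prime) (hl2 : l ≠ 2) (hlp : l ≠ p)
include hp hl hl2 hlp

theorem essDimAt_POmega_addPlusForm {a : ℕ} {N : QuadraticForm F (Fin a → F)}
    (hN : N.Anisotropic) {m : ℕ} (hdim : a + 2 * m ≠ 2 ∨ p = 2) :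
    essDimAt k (POmega (addPlusForm N m)) l = essDimAt k (O (addPlusForm N m)) l := by
  have hcard : Fintype.card (Fin a ⊕ (Fin m ⊕ Fin m)) = a + 2 * m := by simp; omega
  exact essDimAt_POmega hp hl hl2 hlp (regular_addPlusForm hN m) (generatedBy_addPlusForm p hN m)
    (hcard ▸ hdim)

theorem essDimAt_POmega_plusForm {m : ℕ} (hdim : m ≠ 1 ∨ p = 2) :
    essDimAt k (POmega (plusForm F m)) l = essDimAt k (O (plusForm F m)) l := by
  have hN : (0 : QuadraticForm F (Fin 0 → F)).Anisotropic := fun x _ => Subsingleton.elim _ _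
  refine essDimAt_POmega hp hl hl2 hlp
    ((regular_addPlusForm hN m).of_isometryEquiv (plusFormEquiv m).symm)
    ((generatedBy_addPlusForm p hN m).of_isometryEquiv (plusFormEquiv m).symm)
    (hdim.imp_left fun hm => ?_)
  rw [Fintype.card_sum, Fintype.card_fin]
  omega

end POmega

end FiniteOrthogonal

end

open EssDim FiniteOrthogonal in
theorem theorem8_general {k : Type u} [Field k] {F : Type v} [Field F] [Finite F]
    (p r q l d : ℕ) (hp : p.Prime) (hq : q = p ^ r) (hF : Nat.card F = q)
    (hl : l.Prime) (hl2 : l ≠ 2) (hlp : l ≠ p)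
    (hd : IsLeast {e : ℕ | 0 < e ∧ l ∣ q ^ e - 1} d) :
    (∀ (m : ℕ) (c : F), c ≠ 0 →
      essDimAt k (POmega (oddForm c m)) l = essDimAt k (O (oddForm c m)) l ∧
      (Odd d → essDimAt k (O (oddForm c m)) l = essDimAt k (GL (Fin m) F) l) ∧
      (Even d → essDimAt k (O (oddForm c m)) l = essDimAt k (GL (Fin (2 * m)) F) l)) ∧
    (∀ m : ℕ,
      ((m = 1 → p = 2) →
        essDimAt k (POmega (plusForm F m)) l = essDimAt k (O (plusForm F m)) l) ∧
      (Odd d → essDimAt k (O (plusForm F m)) l = essDimAt k (GL (Fin m) F) l) ∧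
      (Even d → Even (2 * m / d) →
        essDimAt k (O (plusForm F m)) l = essDimAt k (GL (Fin (2 * m)) F) l) ∧
      (Even d → Odd (2 * m / d) →
        essDimAt k (O (plusForm F m)) l = essDimAt k (GL (Fin (2 * m - 2)) F) l)) ∧
    (∀ (m : ℕ) (N : QuadraticForm F (Fin 2 → F)), 1 ≤ m → N.Anisotropic →
      ((m = 1 → p = 2) →
        essDimAt k (POmega (minusForm N m)) l = essDimAt k (O (minusForm N m)) l) ∧
      (Odd d → essDimAt k (O (minusForm N m)) l = essDimAt k (GL (Fin (m - 1)) F) l) ∧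
      (Even d → Odd (2 * m / d) →
        essDimAt k (O (minusForm N m)) l = essDimAt k (GL (Fin (2 * m)) F) l) ∧
      (Even d → Even (2 * m / d) →
        essDimAt k (O (minusForm N m)) l = essDimAt k (GL (Fin (2 * m - 2)) F) l)) := by
  subst hF
  have : CharP F p := by
    have := Fintype.ofFinite F
    have := Fact.mk hp
    exact charP_of_card_eq_prime_pow (by rw [← Nat.card_eq_fintype_card, hq])
  have hlq : ¬ l ∣ Nat.card F := fun h =>
    hlp ((Nat.prime_dvd_prime_iff_eq hl hp).mp (hl.dvd_of_dvd_pow (hq ▸ h)))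
  refine ⟨fun m c hc => ⟨?_, ?_, ?_⟩, fun m => ⟨fun hm => ?_, ?_, ?_, ?_⟩,
    fun m N hm hN => ?_⟩
  · exact essDimAt_POmega_addPlusForm hp hl hl2 hlp (anisotropic_smul_proj hc) (.inl (by omega))
  · exact fun hdo => essDimAt_O_oddForm_of_odd hl hl2 hlq hd hdo hc m
  · exact fun hde => essDimAt_O_oddForm_of_even hl hlq hd hde hl2 hc m
  · exact essDimAt_POmega_plusForm hp hl hl2 hlp (imp_iff_not_or.mp hm)
  · exact fun hdo => essDimAt_O_plusForm_of_odd hl hl2 hlq hd hdo m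
  · exact fun hde => essDimAt_O_plusForm_of_even_of_even hl hlq hd hde hl2
  · exact fun hde => essDimAt_O_plusForm_of_even_of_odd hl hlq hd hde hl2
  · obtain ⟨m, rfl⟩ := Nat.exists_eq_add_of_le' hm
    refine ⟨fun hm1 => ?_, ?_, ?_, ?_⟩
    · exact essDimAt_POmega_addPlusForm hp hl hl2 hlp hN
        ((imp_iff_not_or.mp hm1).imp_left (by omega))
    · exact fun hdo => essDimAt_O_addPlusForm_two_of_odd hl hl2 hlq hd hdo hN m
    · exact fun hde => essDimAt_O_addPlusForm_two_of_even_of_odd hl hlq hd hde hl2 hN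
    · exact fun hde => essDimAt_O_addPlusForm_two_of_even_of_even hl hlq hd hde hl2 hN

open EssDim FiniteOrthogonal in
theorem theorem8 {k : Type u} [Field k] {F : Type v} [Field F] [Finite F]
    (p r q l d : ℕ) (hp : p.Prime) (hq : q = p ^ r) (hF : Nat.card F = q)
    (hl : l.Prime) (hl2 : l ≠ 2) (hlp : l ≠ p) (hk : ringChar k ≠ l)
    (hd : IsLeast {e : ℕ | 0 < e ∧ l ∣ q ^ e - 1} d) :
    -- `n = 2m + 1`
    (∀ (m : ℕ) (c : F), c ≠ 0 →
      essDimAt k (POmega (oddForm c m)) l = essDimAt k (O (oddForm c m)) l ∧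
      (Odd d → essDimAt k (O (oddForm c m)) l = essDimAt k (GL (Fin m) F) l) ∧
      (Even d → essDimAt k (O (oddForm c m)) l = essDimAt k (GL (Fin (2 * m)) F) l)) ∧
    -- `n = 2m`, plus type
    (∀ m : ℕ,
      ((m = 1 → p = 2) →
        essDimAt k (POmega (plusForm F m)) l = essDimAt k (O (plusForm F m)) l) ∧
      (Odd d → essDimAt k (O (plusForm F m)) l = essDimAt k (GL (Fin m) F) l) ∧
      (Even d → Even (2 * m / d) →
        essDimAt k (O (plusForm F m)) l = essDimAt k (GL (Fin (2 * m)) F) l) ∧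
      (Even d → Odd (2 * m / d) →
        essDimAt k (O (plusForm F m)) l = essDimAt k (GL (Fin (2 * m - 2)) F) l)) ∧
    -- `n = 2m`, minus type
    (∀ (m : ℕ) (N : QuadraticForm F (Fin 2 → F)), 1 ≤ m → N.Anisotropic →
      ((m = 1 → p = 2) →
        essDimAt k (POmega (minusForm N m)) l = essDimAt k (O (minusForm N m)) l) ∧
      (Odd d → essDimAt k (O (minusForm N m)) l = essDimAt k (GL (Fin (m - 1)) F) l) ∧
      (Even d → Odd (2 * m / d) →
        essDimAt k (O (minusForm N m)) l = essDimAt k (GL (Fin (2 * m)) F) l) ∧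
      (Even d → Even (2 * m / d) →
        essDimAt k (O (minusForm N m)) l = essDimAt k (GL (Fin (2 * m - 2)) F) l)) :=
  theorem8_general p r q l d hp hq hF hl hl2 hlp hd
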